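/- Let $n\ge 1$ and $0<s<1$, and let $P_t(x)=P(x,t;s)$ be the fundamental solution of the fractional heat equation $\partial_t u+(-\Delta)^s u=0$ in $\mathbb{R}^n$, that is, the inverse Fourier transform of $\xi\mapsto e^{-t|\xi|^{2s}}$. For $u_0\in L^1(\mathbb{R}^n)$, a solution with initial datum $u_0$ is a real function $u(x,t)$, $t>0$, such that $u(\cdot,t)$ is integrable and continuous for each $t>0$, its Fourier transform in $x$ satisfies $\partial_t\widehat u(\xi,t)=-|\xi|^{2s}\widehat u(\xi,t)$ for all $\xi$ and $t>0$, and $u(\cdot,t)\to u_0$ in $L^1(\mathbb{R}^n)$ as $t\to0^+$. For every $u_0\in L^1(\mathbb{R}^n)$ the function $u(x,t)=\int_{\mathbb{R}^n} P_t(x-y)u_0(y)\,dy$ is such a solution. Moreover: (1) There are constants $C_1,C_2>0$ depending only on $n$ and $s$ such that, for every $u_0\in L^1(\mathbb{R}^n)$ with mass $M=\int u_0$ and finite first absolute moment $\mathcal N_1(u_0)=\int_{\mathbb{R}^n}|y|\,|u_0(y)|\,dy$, every solution $u$ with initial datum $u_0$ satisfies, for all $t>0$ and all $x\in\mathbb{R}^n$,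 $$t^{n/2s}\,|u(x,t)-M P_t(x)|\le C_1\,\mathcal N_1(u_0)\,t^{-1/2s},\qquad \|u(\cdot,t)-M P_t\|_{L^1(\mathbb{R}^n)}\le C_2\,\mathcal N_1(u_0)\,t^{-1/2s}.$$ (2) The rate $O(t^{-1/2s})$ is optimal in both estimates. First, a translated fundamental solution attains it: for every $h\in\mathbb{R}^n$, $h\ne0$, there are $c,C,T>0$ such that for all $t\ge T$ $$c\,t^{-1/2s}\le t^{n/2s}\,\sup_{x}|P_t(x+h)-P_t(x)|\le C\,t^{-1/2s},\qquad c\,t^{-1/2s}\le \|P_t(\cdot+h)-P_t\|_{L^1(\mathbb{R}^n)}\le C\,t^{-1/2s}.$$ Second, it is attained within the class of data of (1): there are $u_0\in L^1(\mathbb{R}^n)$ with $\mathcal N_1(u_0)<\infty$ and $M=1$, a solution $u$ with initial datum $u_0$, and $c,T>0$ such that for all $t\ge T$ $$t^{n/2s}\,\sup_x|u(x,t)-M P_t(x)|\ge c\,t^{-1/2s},\qquad \|u(\cdot,t)-M P_t\|_{L^1(\mathbb{R}^n)}\ge c\,t^{-1/2s}.$$ -/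

import Mathlib

open MeasureTheory Filter Topology
open scoped FourierTransform

noncomputable section

/-- The Fourier symbol of the fractional Laplacian `(-Δ)^s`. Mathlib's transform is
`𝓕 f ξ = ∫ exp (-2πi⟪x, ξ⟫) f x`, so the angular frequency of `ξ` is `2πξ` and the symbol
`|·|^{2s}` of the angular frequency becomes `(2π‖ξ‖)^{2s}`. -/
def fracLaplacianSymbol {n : ℕ} (s : ℝ) (ξ : EuclideanSpace ℝ (Fin n)) : ℝ :=
  (2 * Real.pi * ‖ξ‖) ^ (2 * s)

/-- The fundamental solution `P_t(x) = P(x,t;s)` of the fractional heat equation: the inverse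
Fourier transform of `exp (-t|·|^{2s})` (this transform is real-valued, the symbol being even). -/
def fracHeatKernel {n : ℕ} (s t : ℝ) (x : EuclideanSpace ℝ (Fin n)) : ℝ :=
  (𝓕⁻ (fun ξ : EuclideanSpace ℝ (Fin n) =>
    (Real.exp (-t * fracLaplacianSymbol s ξ) : ℂ)) x).re

/-- The representation formula `∫ P_t(x - y) u₀(y) dy`. -/
def fracHeatEvolution {n : ℕ} (s : ℝ) (u₀ : EuclideanSpace ℝ (Fin n) → ℝ)
    (t : ℝ) (x : EuclideanSpace ℝ (Fin n)) : ℝ :=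
  ∫ y, fracHeatKernel s t (x - y) * u₀ y

/-- `u = u(t, x)`, `t > 0`, is the (continuous in space) integrable solution of the fractional heat
equation `∂ₜu + (-Δ)^s u = 0` in the whole space with initial datum `u₀`. The operator `(-Δ)^s` is
taken in its definition by Fourier transform in the space variable, so that the equation reads
`∂ₜ û = -|ξ|^{2s} û`, and the initial datum is taken in `L¹`. -/
structure IsFracHeatSolution {n : ℕ} (s : ℝ) (u₀ : EuclideanSpace ℝ (Fin n) → ℝ)
    (u : ℝ → EuclideanSpace ℝ (Fin n) → ℝ) : Prop where
  integrable : ∀ t, 0 < t → Integrable (u t)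
  continuous : ∀ t, 0 < t → Continuous (u t)
  equation : ∀ ξ : EuclideanSpace ℝ (Fin n), ∀ t, 0 < t →
    HasDerivAt (fun τ : ℝ => 𝓕 (fun x => (u τ x : ℂ)) ξ)
      (-(fracLaplacianSymbol s ξ : ℂ) * 𝓕 (fun x => (u t x : ℂ)) ξ) t
  initial : Tendsto (fun t => eLpNorm (fun x => u t x - u₀ x) 1 volume) (𝓝[>] 0) (𝓝 0)

/-- The first absolute moment `∫ |y| |u₀(y)| dy`. -/
def firstAbsMoment {n : ℕ} (u₀ : EuclideanSpace ℝ (Fin n) → ℝ) : ℝ :=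
  ∫ y, ‖y‖ * |u₀ y|

/-- `u₀ ∈ L¹(ℝⁿ)` and its first absolute moment is finite. -/
def HasFiniteFirstMoment {n : ℕ} (u₀ : EuclideanSpace ℝ (Fin n) → ℝ) : Prop :=
  Integrable u₀ ∧ Integrable (fun y => ‖y‖ * |u₀ y|)

end

/-! ### Completely monotone approximations of `exp (-λ ^ s)` -/

/-! On the Fourier side a solution is `û(ξ,t) = û₀(ξ) exp(-t|ξ|^{2s})`. For data with a finite first
moment, `û₀(ξ) - M` is `O(|ξ|)`. Rescaling by `τ = t^{1/2s}` turns this extra factor `|ξ|` into a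
gain of `τ⁻¹`, which is the sup estimate (`pow_mul_norm_fourierInv_mul_fracHeatMultiplier_le`).

The `L¹` estimate is obtained in physical space: `u - M P_t` is the superposition of the differences
`P_t(x-y) - P_t(x)` with weights `u₀(y)`, so it is enough that `‖P_t(·+h) - P_t‖₁ ≤ C|h|t^{-1/2s}`.
That bound, and `P_t ∈ L¹` itself, come from subordination: `exp(-λ^s)` is a limit of Laplace
transforms of discrete sub-probability measures (`exists_discrete_mixtures`). Put `λ = t^{1/s}|ξ|²`:
the kernel is then a pointwise limit of mixtures of Gaussians, and Fatou's lemma passes their `L¹`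
bounds to the limit (`exists_tendsto_fracHeatKernel`). A Gaussian of parameter `r` moves by
`O(|h|/√r)` in `L¹`, so only a uniform negative moment of the mixing measures is needed.

Optimality: if the multiplier `A` is `2πi⟨b,ξ⟩` to first order at the origin, with `b ≠ 0`, the
rescaled difference converges to a nonzero profile, while the `L¹` norm dominates the Fourier
transform at frequency `τ⁻¹b` (`exists_lower_bound_of_multiplier`). For a translate `b = h`; for a
datum `b` is minus its vector first moment.

Every solution is the one given by the representation formula, because `û` solves a linear ODE in
`t` at each frequency. -/

theorem exists_hasSum_one_sub_one_sub_rpow {s : ℝ} (hs0 : 0 < s) (hs1 : s < 1) :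
    ∃ a : ℕ → ℝ, (∀ k, 0 ≤ a k) ∧
      ∀ z : ℝ, 0 ≤ z → z < 1 → HasSum (fun k => a k * z ^ k) (1 - (1 - z) ^ s) := by
  have hsucc : ∀ k : ℕ, ((k : ℝ) + 1) * Ring.choose s (k + 1) = Ring.choose s k * (s - k) := by
    intro k
    have h := Ring.choose_smul_choose s (Nat.le_succ k)
    simpa [Nat.succ_eq_add_one, Ring.choose_one_right] using h
  have hsign : ∀ k : ℕ, 0 ≤ (-1) ^ k * Ring.choose s (k + 1) := by
    intro k
    induction k with
    | zero => simpa [Ring.choose_one_right] using hs0.le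
    | succ k ih =>
      have h := hsucc (k + 1)
      push_cast at h
      -- The ratio of consecutive signed coefficients is `(k+1-s)/(k+2)`, nonnegative because `s <
      -- 1`.
      have h2 : (-1) ^ (k + 1) * Ring.choose s (k + 1 + 1)
          = ((-1) ^ k * Ring.choose s (k + 1)) * ((k + 1 - s) / (k + 1 + 1)) := by
        have : Ring.choose s (k + 1 + 1)
            = Ring.choose s (k + 1) * (s - (k + 1)) / (k + 1 + 1) := by
          field_simp
          linarith
        rw [this]
        ring
      rw [h2]
      have : (0 : ℝ) ≤ k := k.cast_nonneg
      exact mul_nonneg ih (div_nonneg (by linarith) (by linarith))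
  refine ⟨fun k => if k = 0 then 0 else (-1) ^ (k + 1) * Ring.choose s k, ?_, ?_⟩
  · intro k
    rcases k with _ | k
    · simp
    · simpa [pow_succ] using hsign k
  · intro z hz0 hz1
    have h := (Real.one_add_rpow_hasFPowerSeriesOnBall_zero (a := s)).hasSum (y := -z)
      (by simpa [enorm_eq_nnnorm, ← NNReal.coe_lt_one, abs_of_nonneg hz0] using hz1)
    have h1 : HasSum (fun k : ℕ => Ring.choose s k * (-z) ^ k) ((1 - z) ^ s) := by
      simpa [binomialSeries_apply, sub_eq_add_neg, -FormalMultilinearSeries.apply_eq_prod_smul_coeff]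
        using h
    have h2 : HasSum (fun k : ℕ => if k = 0 then (1 : ℝ) else 0) 1 := hasSum_ite_eq 0 1
    convert! h2.sub h1 using 2 with k
    rcases k with _ | k
    · simp
    · simp [neg_pow z, pow_succ]
      ring

/-- Cauchy product: nonnegative terms make both series absolutely summable. -/
theorem HasSum.mul_powerSeries_nonneg {a b : ℕ → ℝ} (ha : ∀ k, 0 ≤ a k) (hb : ∀ k, 0 ≤ b k)
    {z A B : ℝ} (hz : 0 ≤ z) (hA : HasSum (fun k => a k * z ^ k) A)
    (hB : HasSum (fun k => b k * z ^ k) B) :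
    HasSum (fun k => (∑ p ∈ Finset.HasAntidiagonal.antidiagonal k, a p.1 * b p.2) * z ^ k) (A * B) := by
  have hA' : Summable fun k => ‖a k * z ^ k‖ := by
    simpa only [Real.norm_eq_abs, abs_of_nonneg (mul_nonneg (ha _) (pow_nonneg hz _))]
      using hA.summable
  have hB' : Summable fun k => ‖b k * z ^ k‖ := by
    simpa only [Real.norm_eq_abs, abs_of_nonneg (mul_nonneg (hb _) (pow_nonneg hz _))]
      using hB.summable
  have hS := (summable_norm_sum_mul_antidiagonal_of_summable_norm hA' hB').of_norm
  have hT := tsum_mul_tsum_eq_tsum_sum_antidiagonal_of_summable_norm hA' hB'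
  rw [hA.tsum_eq, hB.tsum_eq] at hT
  rw [hT]
  convert! hS.hasSum using 2 with k
  rw [Finset.sum_mul]
  refine Finset.sum_congr rfl fun p hp => ?_
  rw [← Finset.HasAntidiagonal.mem_antidiagonal.1 hp, pow_add]
  ring

theorem exists_hasSum_pow {s : ℝ} (hs0 : 0 < s) (hs1 : s < 1) (m : ℕ) :
    ∃ a : ℕ → ℝ, (∀ k, 0 ≤ a k) ∧
      ∀ z : ℝ, 0 ≤ z → z < 1 → HasSum (fun k => a k * z ^ k) ((1 - (1 - z) ^ s) ^ m) := by
  induction m with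
  | zero =>
    refine ⟨fun k => if k = 0 then 1 else 0, fun k => by dsimp only; split_ifs <;> simp, fun z _ _ => ?_⟩
    convert! hasSum_ite_eq (0 : ℕ) (1 : ℝ) using 2 with k
    rcases k with _ | k <;> simp
  | succ m ih =>
    obtain ⟨a, ha, hA⟩ := ih
    obtain ⟨b, hb, hB⟩ := exists_hasSum_one_sub_one_sub_rpow hs0 hs1
    refine ⟨fun k => ∑ p ∈ Finset.HasAntidiagonal.antidiagonal k, a p.1 * b p.2,
      fun k => Finset.sum_nonneg fun p _ => mul_nonneg (ha _) (hb _), fun z hz0 hz1 => ?_⟩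
    rw [pow_succ]
    exact (hA z hz0 hz1).mul_powerSeries_nonneg ha hb hz0 (hB z hz0 hz1)

/-- The Laplace transform of the law of `m ^ (-1/s) (X₁ + ⋯ + X_m)`, where the `X_i` are independent
with probability generating function `1 - (1 - z) ^ s`. -/
noncomputable def stableApprox (s : ℝ) (m : ℕ) (l : ℝ) : ℝ :=
  (1 - (1 - Real.exp (-(l * (m : ℝ) ^ (-(1 / s))))) ^ s) ^ m

theorem one_sub_one_sub_rpow_nonneg {s z : ℝ} (hs0 : 0 < s) (hz0 : 0 ≤ z) (hz1 : z ≤ 1) :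
    0 ≤ 1 - (1 - z) ^ s := by
  have := Real.rpow_le_one (x := 1 - z) (by linarith) (by linarith) hs0.le
  linarith

theorem one_sub_one_sub_rpow_le {s z : ℝ} (hs1 : s < 1) (hz0 : 0 ≤ z) (hz1 : z < 1) :
    1 - (1 - z) ^ s ≤ z := by
  have := Real.rpow_le_rpow_of_exponent_ge (x := 1 - z) (by linarith) (by linarith) hs1.le
  rw [Real.rpow_one] at this
  linarith

theorem stableApprox_nonneg {s : ℝ} (hs0 : 0 < s) (m : ℕ) {l : ℝ} (hl : 0 ≤ l) :
    0 ≤ stableApprox s m l := by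
  refine pow_nonneg (one_sub_one_sub_rpow_nonneg hs0 (Real.exp_pos _).le ?_) _
  rw [Real.exp_le_one_iff, neg_nonpos]
  positivity

theorem stableApprox_le_one {s : ℝ} (hs0 : 0 < s) (m : ℕ) {l : ℝ} (hl : 0 ≤ l) :
    stableApprox s m l ≤ 1 := by
  have h1 : Real.exp (-(l * (m : ℝ) ^ (-(1 / s)))) ≤ 1 := by
    rw [Real.exp_le_one_iff, neg_nonpos]
    positivity
  refine pow_le_one₀ (one_sub_one_sub_rpow_nonneg hs0 (Real.exp_pos _).le h1) ?_
  have := Real.rpow_nonneg (x := 1 - Real.exp (-(l * (m : ℝ) ^ (-(1 / s))))) (by linarith) s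
  linarith

/-- With `u = l m^{-1/s}`, `1 - e^{-u} ~ u` gives `(1 - e^{-u})^s ~ l^s/m`, and `(1 - l^s/m)^m →
exp(-l^s)`. -/
theorem tendsto_stableApprox {s : ℝ} (hs0 : 0 < s) {l : ℝ} (hl : 0 < l) :
    Tendsto (fun m => stableApprox s m l) atTop (𝓝 (Real.exp (-l ^ s))) := by
  have he : Tendsto (fun m : ℕ => l * (m : ℝ) ^ (-(1 / s))) atTop (𝓝[≠] 0) := by
    refine tendsto_nhdsWithin_iff.2 ⟨?_, ?_⟩
    · simpa using ((tendsto_rpow_neg_atTop (y := 1 / s) (by positivity)).comp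
        tendsto_natCast_atTop_atTop).const_mul l
    · filter_upwards [eventually_gt_atTop 0] with m hm
      have : (0 : ℝ) < m := by exact_mod_cast hm
      exact (by positivity : l * (m : ℝ) ^ (-(1 / s)) ≠ 0)
  have hd : Tendsto (fun u : ℝ => (1 - Real.exp (-u)) / u) (𝓝[≠] 0) (𝓝 1) := by
    have h : HasDerivAt (fun u : ℝ => 1 - Real.exp (-u)) 1 0 := by
      have := ((hasDerivAt_id (0 : ℝ)).neg.exp).const_sub 1
      simpa using this
    have := h.tendsto_slope
    refine this.congr fun u => ?_
    simp [slope_def_field]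
  have h1 := ((hd.comp he).mul_const l).rpow_const (p := s) (Or.inr hs0.le)
  have h2 : Tendsto (fun m : ℕ => (m : ℝ) * -(1 - Real.exp (-(l * (m : ℝ) ^ (-(1 / s))))) ^ s)
      atTop (𝓝 (-l ^ s)) := by
    rw [one_mul] at h1
    refine h1.neg.congr' ?_
    filter_upwards [eventually_gt_atTop 0] with m hm
    have hm' : (0 : ℝ) < m := by exact_mod_cast hm
    have hx : Real.exp (-(l * (m : ℝ) ^ (-(1 / s)))) ≤ 1 := by
      rw [Real.exp_le_one_iff, neg_nonpos]
      positivity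
    have : (1 - Real.exp (-(l * (m : ℝ) ^ (-(1 / s))))) / (l * (m : ℝ) ^ (-(1 / s))) * l
        = (m : ℝ) ^ (1 / s) * (1 - Real.exp (-(l * (m : ℝ) ^ (-(1 / s))))) := by
      rw [Real.rpow_neg hm'.le]
      field_simp
    simp only [Function.comp_apply]
    rw [this, Real.mul_rpow (by positivity) (by linarith), ← Real.rpow_mul hm'.le,
      one_div_mul_cancel hs0.ne', Real.rpow_one]
    ring
  refine (Real.tendsto_one_add_pow_exp_of_tendsto h2).congr fun m => ?_
  rw [stableApprox, ← sub_eq_add_neg]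

theorem exists_forall_rpow_mul_exp_neg_le (p : ℝ) {c s : ℝ} (hc : 0 < c) (hs : 0 < s) (hp : 0 ≤ p) :
    ∃ K : ℝ, ∀ x : ℝ, 0 ≤ x → x ^ p * Real.exp (-c * x ^ s) ≤ K := by
  have h : Tendsto (fun y : ℝ => y ^ (p / s) * Real.exp (-c * y)) atTop (𝓝 0) :=
    tendsto_rpow_mul_exp_neg_mul_atTop_nhds_zero _ _ hc
  have hcont : ContinuousOn (fun y : ℝ => y ^ (p / s) * Real.exp (-c * y)) (Set.Ici 0) := by
    have : 0 ≤ p / s := by positivity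
    fun_prop (disch := intros; first | assumption | (right; assumption))
  obtain ⟨N, hN⟩ := eventually_atTop.1 (h.eventually (gt_mem_nhds one_pos))
  obtain ⟨B, hB⟩ := (isCompact_Icc (a := (0 : ℝ)) (b := N)).bddAbove_image
    (hcont.mono Set.Icc_subset_Ici_self)
  refine ⟨max 1 B, fun x hx => ?_⟩
  have hx' : x ^ p = (x ^ s) ^ (p / s) := by
    rw [← Real.rpow_mul hx]
    congr 1
    field_simp
  rw [hx']
  rcases le_total N (x ^ s) with h' | h'
  · exact (hN _ h').le.trans (le_max_left _ _)
  · exact (hB ⟨x ^ s, ⟨Real.rpow_nonneg hx _, h'⟩, rfl⟩).trans (le_max_right _ _)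

theorem half_mul_le_one_sub_exp_neg {u : ℝ} (hu0 : 0 ≤ u) (hu1 : u ≤ 1) :
    u / 2 ≤ 1 - Real.exp (-u) := by
  have h1 : Real.exp (-u) * (1 + u) ≤ 1 := by
    have := mul_le_mul_of_nonneg_left (Real.add_one_le_exp u) (Real.exp_pos (-u)).le
    rw [← Real.exp_add, neg_add_cancel, Real.exp_zero] at this
    linarith
  nlinarith [Real.exp_pos (-u)]

/-- Decay uniform in `m`, which supplies the dominating functions later. Let `u = l m^{-1/s}`. For
`u ≤ 1`, `1 - e^{-u} ≥ u/2` yields the bound `exp(-(l/2)^s)`. For `u ≥ 1`, `1 - (1-z)^s ≤ z` yields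
`exp(-mu)`, while `l^p = m^{p/s} u^p`. -/
theorem exists_rpow_mul_stableApprox_le {s : ℝ} (hs0 : 0 < s) (hs1 : s < 1) {p : ℝ} (hp : 0 ≤ p) :
    ∃ K : ℝ, ∀ m : ℕ, 2 ≤ m → ∀ l : ℝ, 0 < l → l ^ p * stableApprox s m l ≤ K := by
  obtain ⟨K₁, hK₁⟩ := exists_forall_rpow_mul_exp_neg_le p
    (c := (1 / 2) ^ s) (s := s) (by positivity) hs0 hp
  obtain ⟨K₂, hK₂⟩ := exists_forall_rpow_mul_exp_neg_le (p / s)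
    (c := 1 / 2) (s := 1) (by norm_num) one_pos (by positivity)
  obtain ⟨K₃, hK₃⟩ := exists_forall_rpow_mul_exp_neg_le p
    (c := 1 / 2) (s := 1) (by norm_num) one_pos hp
  refine ⟨max K₁ (K₂ * K₃), fun m hm l hl => ?_⟩
  have hm2 : (2 : ℝ) ≤ m := by exact_mod_cast hm
  have hm0 : (0 : ℝ) < m := by linarith
  set u := l * (m : ℝ) ^ (-(1 / s)) with hu
  have hu0 : 0 < u := by positivity
  have hlu : l = (m : ℝ) ^ (1 / s) * u := by
    rw [hu, Real.rpow_neg hm0.le]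
    field_simp
  have hz1 : Real.exp (-u) < 1 := by simpa using hu0
  have hq0 := one_sub_one_sub_rpow_nonneg hs0 (Real.exp_pos (-u)).le hz1.le
  have hdef : stableApprox s m l = (1 - (1 - Real.exp (-u)) ^ s) ^ m := rfl
  rw [hdef]
  rcases le_total u 1 with h | h
  · refine le_trans ?_ (le_max_left _ _)
    refine le_trans (mul_le_mul_of_nonneg_left ?_ (by positivity)) (hK₁ l hl.le)
    have h1 : (u / 2) ^ s ≤ (1 - Real.exp (-u)) ^ s :=
      Real.rpow_le_rpow (by positivity) (half_mul_le_one_sub_exp_neg hu0.le h) hs0.le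
    have h2 : 1 - (1 - Real.exp (-u)) ^ s ≤ Real.exp (-(u / 2) ^ s) := by
      have := Real.add_one_le_exp (-(u / 2) ^ s)
      linarith
    have h3 : (m : ℝ) * (u / 2) ^ s = (1 / 2) ^ s * l ^ s := by
      rw [hlu, Real.mul_rpow (by positivity) hu0.le, ← Real.rpow_mul hm0.le,
        one_div_mul_cancel hs0.ne', Real.rpow_one, div_eq_mul_one_div, Real.mul_rpow hu0.le (by norm_num)]
      ring
    calc (1 - (1 - Real.exp (-u)) ^ s) ^ m ≤ Real.exp (-(u / 2) ^ s) ^ m :=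
          pow_le_pow_left₀ hq0 h2 _
      _ = Real.exp (-(1 / 2) ^ s * l ^ s) := by
          rw [← Real.exp_nat_mul]
          congr 1
          linarith
  · refine le_trans ?_ (le_max_right _ _)
    have h1 : (1 - (1 - Real.exp (-u)) ^ s) ^ m ≤ Real.exp (-u) ^ m :=
      pow_le_pow_left₀ hq0 (one_sub_one_sub_rpow_le hs1 (Real.exp_pos _).le hz1) _
    -- As `m, u ≥ 1`, `mu ≥ (m+u)/2`, so the exponential splits into one factor for each variable.
    have h2 : Real.exp (-u) ^ m ≤ Real.exp (-(1 / 2) * (m : ℝ) ^ (1 : ℝ)) *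
        Real.exp (-(1 / 2) * u ^ (1 : ℝ)) := by
      rw [← Real.exp_nat_mul, ← Real.exp_add, Real.exp_le_exp, Real.rpow_one, Real.rpow_one]
      nlinarith
    have h3 : l ^ p = (m : ℝ) ^ (p / s) * u ^ p := by
      rw [hlu, Real.mul_rpow (by positivity) hu0.le, ← Real.rpow_mul hm0.le]
      congr 2
      ring
    calc l ^ p * (1 - (1 - Real.exp (-u)) ^ s) ^ m
        ≤ ((m : ℝ) ^ (p / s) * u ^ p) * (Real.exp (-(1 / 2) * (m : ℝ) ^ (1 : ℝ)) *
        Real.exp (-(1 / 2) * u ^ (1 : ℝ))) := by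
          rw [h3]
          exact mul_le_mul_of_nonneg_left (h1.trans h2) (by positivity)
      _ = ((m : ℝ) ^ (p / s) * Real.exp (-(1 / 2) * (m : ℝ) ^ (1 : ℝ))) *
          (u ^ p * Real.exp (-(1 / 2) * u ^ (1 : ℝ))) := by ring
      _ ≤ K₂ * K₃ := by
          refine mul_le_mul (hK₂ _ hm0.le) (hK₃ _ hu0.le) (by positivity) ?_
          exact le_trans (by positivity) (hK₂ _ hm0.le)

/-- `exp (-λ ^ s)` is the limit of Laplace transforms of discrete sub-probability measures on
`(0, ∞)`, with uniform decay and uniformly bounded moments of order `-1`. -/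
theorem exists_discrete_mixtures {s : ℝ} (hs0 : 0 < s) (hs1 : s < 1) :
    ∃ (p r : ℕ → ℕ → ℝ) (ρ : ℕ → ℝ) (F : ℕ → ℝ → ℝ),
      (∀ m k, 0 ≤ p m k) ∧ (∀ m, 0 < ρ m) ∧ (∀ m k, ρ m ≤ r m k) ∧
      (∀ m, Summable (p m)) ∧ (∀ m, ∑' k, p m k ≤ 1) ∧
      (∀ m l, 0 < l → HasSum (fun k => p m k * Real.exp (-(r m k * l))) (F m l)) ∧
      (∀ l, 0 < l → Tendsto (fun m => F m l) atTop (𝓝 (Real.exp (-l ^ s)))) ∧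
      (∀ q : ℝ, 0 ≤ q → ∃ K, ∀ m l, 0 < l → l ^ q * F m l ≤ K) ∧
      (∃ K, ∀ m, Summable (fun k => p m k / r m k) ∧ ∑' k, p m k / r m k ≤ K) := by
  choose a ha hsum using fun m : ℕ => exists_hasSum_pow hs0 hs1 (m + 2)
  set ρ : ℕ → ℝ := fun m => ((m + 2 : ℕ) : ℝ) ^ (-(1 / s)) with hρ
  have hρ0 : ∀ m, 0 < ρ m := fun m => by
    have : (0 : ℝ) < ((m + 2 : ℕ) : ℝ) := by positivity
    exact Real.rpow_pos_of_pos this _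
  -- There is no atom at zero, which would correspond to a degenerate Gaussian.
  have ha0 : ∀ m, a m 0 = 0 := by
    intro m
    have h := hsum m 0 le_rfl one_pos
    have h' : HasSum (fun k => a m k * 0 ^ k) (a m 0) := by
      convert! hasSum_single (f := fun k => a m k * (0 : ℝ) ^ k) 0 ?_ using 1
      · simp
      · intro k hk
        simp [hk]
    have := h.unique h'
    rw [← this]
    simp
  -- The series is only controlled for `z < 1`; finite partial sums survive the limit `z → 1⁻`.
  have hfin : ∀ m (S : Finset ℕ), ∑ k ∈ S, a m k ≤ 1 := by
    intro m S
    have hc : Tendsto (fun z : ℝ => ∑ k ∈ S, a m k * z ^ k) (𝓝[<] 1) (𝓝 (∑ k ∈ S, a m k * 1 ^ k)) := by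
      refine (Continuous.tendsto ?_ 1).mono_left nhdsWithin_le_nhds
      fun_prop
    simp only [one_pow, mul_one] at hc
    refine le_of_tendsto hc ?_
    filter_upwards [Ioo_mem_nhdsLT (zero_lt_one (α := ℝ))] with z hz
    refine (sum_le_hasSum S (fun k _ => mul_nonneg (ha m k) (pow_nonneg hz.1.le _))
      (hsum m z hz.1.le hz.2)).trans ?_
    refine pow_le_one₀ (one_sub_one_sub_rpow_nonneg hs0 hz.1.le hz.2.le) ?_
    have := Real.rpow_nonneg (x := 1 - z) (by linarith [hz.2]) s
    linarith
  have hasum : ∀ m, Summable (a m) := fun m =>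
    summable_of_sum_le (ha m) (hfin m)
  -- The weight at `k = 0` vanishes, so `max k 1` alters no sum and keeps every parameter at least
  -- `ρ m > 0`.
  set r : ℕ → ℕ → ℝ := fun m k => max (k : ℝ) 1 * ρ m with hr
  have hrρ : ∀ m k, ρ m ≤ r m k := fun m k =>
    le_mul_of_one_le_left (hρ0 m).le (le_max_right _ _)
  have hr0 : ∀ m k, 0 < r m k := fun m k => (hρ0 m).trans_le (hrρ m k)
  have hF : ∀ m l, 0 < l →
      HasSum (fun k => a m k * Real.exp (-(r m k * l))) (stableApprox s (m + 2) l) := by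
    intro m l hl
    have hx : 0 < l * ρ m := mul_pos hl (hρ0 m)
    have h := hsum m (Real.exp (-(l * ρ m))) (Real.exp_pos _).le (by simpa using hx)
    convert! h using 2 with k
    rcases k with _ | k
    · simp [ha0]
    · rw [← Real.exp_nat_mul]
      congr 2
      have : max ((k + 1 : ℕ) : ℝ) 1 = ((k + 1 : ℕ) : ℝ) := max_eq_left (by simp)
      simp only [hr, this]
      ring
  have hK : ∀ q : ℝ, 0 ≤ q → ∃ K, ∀ m l, 0 < l → l ^ q * stableApprox s (m + 2) l ≤ K := by
    intro q hq
    obtain ⟨K, hK⟩ := exists_rpow_mul_stableApprox_le hs0 hs1 hq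
    exact ⟨K, fun m l hl => hK (m + 2) (by omega) l hl⟩
  refine ⟨a, r, ρ, fun m l => stableApprox s (m + 2) l, ha, hρ0, hrρ, hasum,
    fun m => (hasum m).tsum_le_of_sum_le (hfin m), hF,
    fun l hl => (tendsto_stableApprox hs0 hl).comp (tendsto_add_atTop_nat 2), hK, ?_⟩
  -- Since `1/r = ∫₀^∞ e^{-rl} dl`, the moment of order `-1` is controlled by the integral of the
  -- Laplace transform `F`. From `F ≤ 1` and `l²F ≤ K` comes the majorant `(1+K)/(1+l²)`, of
  -- integral `(1+K)π` over the line.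
  obtain ⟨K, hK2⟩ := hK 2 (by norm_num)
  refine ⟨(1 + K) * Real.pi, fun m => ?_⟩
  have hbound : ∀ S : Finset ℕ, ∑ k ∈ S, a m k / r m k ≤ (1 + K) * Real.pi := by
    intro S
    have hint : ∀ k, IntegrableOn (fun l => Real.exp (-(r m k) * l)) (Set.Ioi 0) := fun k =>
      exp_neg_integrableOn_Ioi 0 (hr0 m k)
    have h1 : ∑ k ∈ S, a m k / r m k
        = ∫ l in Set.Ioi (0 : ℝ), ∑ k ∈ S, a m k * Real.exp (-(r m k) * l) := by
      rw [integral_finsetSum _ fun k _ => (hint k).const_mul _]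
      refine Finset.sum_congr rfl fun k _ => ?_
      rw [integral_const_mul, integral_exp_mul_Ioi (by linarith [hr0 m k])]
      simp
      ring
    have hpos : ∀ l : ℝ, 0 ≤ (1 + K) * (1 + l ^ 2)⁻¹ := by
      intro l
      have : 0 ≤ K := le_trans (mul_nonneg (by positivity) (stableApprox_nonneg hs0 _ zero_le_one))
        (hK2 0 1 one_pos)
      positivity
    rw [h1, ← integral_univ_inv_one_add_sq, ← integral_const_mul]
    calc _ ≤ ∫ l in Set.Ioi (0 : ℝ), (1 + K) * (1 + l ^ 2)⁻¹ := by
          refine setIntegral_mono_on (integrable_finsetSum _ fun k _ => (hint k).const_mul _)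
            (integrable_inv_one_add_sq.const_mul _).integrableOn measurableSet_Ioi fun l hl => ?_
          have hl0 : (0 : ℝ) < l := hl
          have h2 : ∑ k ∈ S, a m k * Real.exp (-(r m k) * l) ≤ stableApprox s (m + 2) l := by
            simp only [neg_mul]
            exact sum_le_hasSum S (fun k _ => mul_nonneg (ha m k) (Real.exp_pos _).le) (hF m l hl0)
          refine h2.trans ?_
          rw [← div_eq_mul_inv, le_div_iff₀ (by positivity)]
          have h3 := hK2 m l hl0
          rw [Real.rpow_two] at h3
          have h4 := stableApprox_le_one hs0 (m + 2) hl0.le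
          nlinarith
      _ ≤ ∫ l, (1 + K) * (1 + l ^ 2)⁻¹ :=
          setIntegral_le_integral (integrable_inv_one_add_sq.const_mul _)
            (Eventually.of_forall hpos)
  have hnn : ∀ k, 0 ≤ a m k / r m k := fun k => div_nonneg (ha m k) (hr0 m k).le
  have hsm := summable_of_sum_le hnn hbound
  exact ⟨hsm, hsm.tsum_le_of_sum_le hbound⟩

/-! ### Gaussians and translations in `L¹` -/

/-- Integrate the derivative along the segment from `x` to `x + h`, then apply Tonelli and
translation invariance. -/
theorem lintegral_enorm_comp_add_sub_le {n : ℕ} {f : EuclideanSpace ℝ (Fin n) → ℝ}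
    {f' : EuclideanSpace ℝ (Fin n) → EuclideanSpace ℝ (Fin n) →L[ℝ] ℝ}
    (hf : ∀ x, HasFDerivAt f (f' x) x) (hf' : Continuous f') (h : EuclideanSpace ℝ (Fin n)) :
    ∫⁻ x, ‖f (x + h) - f x‖ₑ ≤ ‖h‖ₑ * ∫⁻ x, ‖f' x‖ₑ := by
  have hpt : ∀ x, ‖f (x + h) - f x‖ₑ ≤ ∫⁻ τ in Set.Ioc (0 : ℝ) 1, ‖h‖ₑ * ‖f' (x + τ • h)‖ₑ := by
    intro x
    have hd : ∀ τ : ℝ, HasDerivAt (fun τ : ℝ => f (x + τ • h)) (f' (x + τ • h) h) τ := by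
      intro τ
      have h1 : HasDerivAt (fun τ : ℝ => x + τ • h) h τ := by
        simpa using ((hasDerivAt_id τ).smul_const h).const_add x
      exact (hf (x + τ • h)).comp_hasDerivAt τ h1
    have hc : Continuous fun τ : ℝ => f' (x + τ • h) h := by fun_prop
    have h2 := intervalIntegral.integral_eq_sub_of_hasDerivAt (a := 0) (b := 1)
      (fun τ _ => hd τ) (hc.intervalIntegrable 0 1)
    simp only [one_smul, zero_smul, add_zero] at h2
    rw [← h2, intervalIntegral.integral_of_le zero_le_one]
    refine (enorm_integral_le_lintegral_enorm _).trans (lintegral_mono fun τ => ?_)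
    rw [mul_comm]
    exact (f' (x + τ • h)).le_opENorm h
  calc ∫⁻ x, ‖f (x + h) - f x‖ₑ
      ≤ ∫⁻ x, ∫⁻ τ in Set.Ioc (0 : ℝ) 1, ‖h‖ₑ * ‖f' (x + τ • h)‖ₑ := lintegral_mono hpt
    _ = ∫⁻ τ in Set.Ioc (0 : ℝ) 1, ∫⁻ x, ‖h‖ₑ * ‖f' (x + τ • h)‖ₑ := by
        refine lintegral_lintegral_swap (Continuous.aemeasurable ?_)
        exact (ENNReal.continuous_const_mul enorm_ne_top).comp (by fun_prop)
    _ = ∫⁻ τ in Set.Ioc (0 : ℝ) 1, ‖h‖ₑ * ∫⁻ x, ‖f' x‖ₑ := by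
        refine lintegral_congr fun τ => ?_
        rw [lintegral_const_mul' _ _ enorm_ne_top,
          lintegral_add_right_eq_self (fun x => ‖f' x‖ₑ)]
    _ = ‖h‖ₑ * ∫⁻ x, ‖f' x‖ₑ := by simp

/-- The classical heat kernel `(4πr)^{-n/2} exp (-|x|²/(4r))`. -/
noncomputable def gaussKernel {n : ℕ} (r : ℝ) (x : EuclideanSpace ℝ (Fin n)) : ℝ :=
  (4 * Real.pi * r) ^ (-((n : ℝ) / 2)) * Real.exp (-(4 * r)⁻¹ * ‖x‖ ^ 2)

section gaussKernel

variable {n : ℕ} {r : ℝ}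

theorem gaussKernel_nonneg (hr : 0 < r) (x : EuclideanSpace ℝ (Fin n)) : 0 ≤ gaussKernel r x := by
  unfold gaussKernel
  positivity

theorem continuous_gaussKernel : Continuous (gaussKernel (n := n) r) := by
  unfold gaussKernel
  fun_prop

theorem integral_gaussKernel (hr : 0 < r) :
    ∫ x : EuclideanSpace ℝ (Fin n), gaussKernel r x = 1 := by
  unfold gaussKernel
  rw [integral_const_mul, GaussianFourier.integral_rexp_neg_mul_sq_norm (by positivity)]
  have : Real.pi / (4 * r)⁻¹ = 4 * Real.pi * r := by field_simp
  rw [this, ← Real.rpow_add (by positivity)]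
  simp

theorem integrable_gaussKernel (hr : 0 < r) :
    Integrable (gaussKernel (n := n) r) :=
  Integrable.of_integral_ne_zero (by rw [integral_gaussKernel hr]; exact one_ne_zero)

theorem lintegral_gaussKernel (hr : 0 < r) :
    ∫⁻ x : EuclideanSpace ℝ (Fin n), ‖gaussKernel r x‖ₑ = 1 := by
  have h := ofReal_integral_norm_eq_lintegral_enorm (integrable_gaussKernel (n := n) hr)
  rw [← h]
  simp only [Real.norm_eq_abs, abs_of_nonneg (gaussKernel_nonneg hr _)]
  rw [integral_gaussKernel hr, ENNReal.ofReal_one]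

theorem fourierInv_exp_neg_mul_sq (hr : 0 < r) (x : EuclideanSpace ℝ (Fin n)) :
    𝓕⁻ (fun ξ : EuclideanSpace ℝ (Fin n) =>
      (Real.exp (-(r * (2 * Real.pi * ‖ξ‖) ^ 2)) : ℂ)) x = (gaussKernel r x : ℂ) := by
  have hb : (0 : ℝ) < 4 * Real.pi ^ 2 * r := by positivity
  have h := fourier_gaussian_innerProductSpace (V := EuclideanSpace ℝ (Fin n))
    (b := ((4 * Real.pi ^ 2 * r : ℝ) : ℂ)) (by rwa [Complex.ofReal_re]) (-x)
  have hfun : (fun ξ : EuclideanSpace ℝ (Fin n) =>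
      (Real.exp (-(r * (2 * Real.pi * ‖ξ‖) ^ 2)) : ℂ))
      = fun ξ => Complex.exp (-((4 * Real.pi ^ 2 * r : ℝ) : ℂ) * ‖ξ‖ ^ 2) := by
    ext ξ
    push_cast
    congr 1
    ring
  rw [Real.fourierInv_eq_fourier_neg, hfun, h]
  have h1 : ((Real.pi : ℂ) / ((4 * Real.pi ^ 2 * r : ℝ) : ℂ)) = ((4 * Real.pi * r : ℝ)⁻¹ : ℝ) := by
    push_cast
    have : (Real.pi : ℂ) ≠ 0 := by exact_mod_cast Real.pi_ne_zero
    have : (r : ℂ) ≠ 0 := by exact_mod_cast hr.ne'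
    field_simp
  have h2 : ((Module.finrank ℝ (EuclideanSpace ℝ (Fin n)) : ℂ) / 2) = (((n : ℝ) / 2 : ℝ) : ℂ) := by
    simp
  rw [h1, h2, ← Complex.ofReal_cpow (by positivity), gaussKernel,
    Real.rpow_neg (by positivity), Real.inv_rpow (by positivity)]
  push_cast
  congr 2
  have : (Real.pi : ℂ) ≠ 0 := by exact_mod_cast Real.pi_ne_zero
  have : (r : ℂ) ≠ 0 := by exact_mod_cast hr.ne'
  rw [norm_neg]
  field_simp

theorem lintegral_enorm_gaussKernel_comp_add_sub_le (hr : 0 < r) (h : EuclideanSpace ℝ (Fin n)) :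
    ∫⁻ x, ‖gaussKernel r (x + h) - gaussKernel r x‖ₑ
      ≤ ENNReal.ofReal (2 ^ ((n : ℝ) / 2) * ‖h‖ / √r) := by
  set f' : EuclideanSpace ℝ (Fin n) → EuclideanSpace ℝ (Fin n) →L[ℝ] ℝ := fun x =>
    (gaussKernel r x * (-(2 * r)⁻¹)) • innerSL ℝ x with hf'
  have hd : ∀ x, HasFDerivAt (gaussKernel r) (f' x) x := by
    intro x
    have h1 := (((hasStrictFDerivAt_norm_sq x).hasFDerivAt.const_mul (-(4 * r)⁻¹)).exp).const_mul
      ((4 * Real.pi * r) ^ (-((n : ℝ) / 2)))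
    convert! h1 using 1
    ext y
    simp [hf', gaussKernel]
    ring
  have hc : Continuous f' := by
    have := continuous_gaussKernel (n := n) (r := r)
    fun_prop
  -- The gradient of a Gaussian is dominated by a Gaussian of twice the parameter, whose mass is 1.
  -- With `y = ‖x‖/(2√r)` the claim becomes `y ≤ exp(y²/2)`.
  have hb : ∀ x, ‖f' x‖ₑ ≤ ENNReal.ofReal (2 ^ ((n : ℝ) / 2) / √r) * ‖gaussKernel (2 * r) x‖ₑ := by
    intro x
    rw [Real.enorm_of_nonneg (gaussKernel_nonneg (by positivity) x),
      ← ENNReal.ofReal_mul (by positivity), ← ofReal_norm]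
    refine ENNReal.ofReal_le_ofReal ?_
    rw [hf', norm_smul, innerSL_apply_norm, norm_mul, Real.norm_of_nonneg (gaussKernel_nonneg hr x),
      norm_neg, Real.norm_of_nonneg (by positivity)]
    set y := ‖x‖ / (2 * √r) with hy
    have hsq : √r ^ 2 = r := Real.sq_sqrt hr.le
    have hsr : 0 < √r := Real.sqrt_pos.2 hr
    have hyx : ‖x‖ = 2 * √r * y := by
      rw [hy]
      field_simp
    have hy2 : y ≤ Real.exp (y ^ 2 / 2) := by
      have := Real.add_one_le_exp (y ^ 2 / 2)
      nlinarith [sq_nonneg (y - 1)]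
    have e1 : -(4 * r)⁻¹ * ‖x‖ ^ 2 = -y ^ 2 := by
      rw [hyx, mul_pow, mul_pow, hsq]
      field_simp
      norm_num
    have e2 : -(4 * (2 * r))⁻¹ * ‖x‖ ^ 2 = -y ^ 2 + y ^ 2 / 2 := by
      rw [hyx, mul_pow, mul_pow, hsq]
      field_simp
      norm_num
    have e3 : (4 * Real.pi * (2 * r)) ^ (-((n : ℝ) / 2))
        = (4 * Real.pi * r) ^ (-((n : ℝ) / 2)) * (2 ^ ((n : ℝ) / 2))⁻¹ := by
      rw [← Real.rpow_neg (by norm_num), ← Real.mul_rpow (by positivity) (by norm_num)]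
      congr 1
      ring
    rw [gaussKernel, gaussKernel, e1, e2, e3, Real.exp_add, hyx]
    have e4 : (4 * Real.pi * r) ^ (-((n : ℝ) / 2)) * Real.exp (-y ^ 2) * (2 * r)⁻¹ * (2 * √r * y)
        = ((4 * Real.pi * r) ^ (-((n : ℝ) / 2)) * Real.exp (-y ^ 2) / √r) * y := by
      nth_rewrite 2 [← hsq]
      field_simp
    have e5 : 2 ^ ((n : ℝ) / 2) / √r * ((4 * Real.pi * r) ^ (-((n : ℝ) / 2)) *
        (2 ^ ((n : ℝ) / 2))⁻¹ * (Real.exp (-y ^ 2) * Real.exp (y ^ 2 / 2)))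
        = ((4 * Real.pi * r) ^ (-((n : ℝ) / 2)) * Real.exp (-y ^ 2) / √r)
          * Real.exp (y ^ 2 / 2) := by
      have : (2 : ℝ) ^ ((n : ℝ) / 2) ≠ 0 := by positivity
      field_simp
    rw [e4, e5]
    exact mul_le_mul_of_nonneg_left hy2 (by positivity)
  refine (lintegral_enorm_comp_add_sub_le hd hc h).trans ?_
  calc ‖h‖ₑ * ∫⁻ x, ‖f' x‖ₑ
      ≤ ‖h‖ₑ * ∫⁻ x, ENNReal.ofReal (2 ^ ((n : ℝ) / 2) / √r) *
          ‖gaussKernel (2 * r) (x : EuclideanSpace ℝ (Fin n))‖ₑ := by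
        gcongr with x
        exact hb x
    _ = ENNReal.ofReal (2 ^ ((n : ℝ) / 2) * ‖h‖ / √r) := by
        rw [lintegral_const_mul' _ _ ENNReal.ofReal_ne_top, lintegral_gaussKernel (by positivity),
          mul_one, ← ofReal_norm, ← ENNReal.ofReal_mul (norm_nonneg _)]
        congr 1
        ring

end gaussKernel

/-! ### Mixtures of Gaussians -/

section mixture

variable {n : ℕ} {p R : ℕ → ℝ} {ρ : ℝ}

theorem Real.continuous_fourier {n : ℕ} {f : EuclideanSpace ℝ (Fin n) → ℂ} (hf : Integrable f) :
    Continuous (𝓕 f) :=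
  VectorFourier.fourierIntegral_continuous Real.continuous_fourierChar continuous_inner hf

theorem Real.continuous_fourierInv {n : ℕ} {f : EuclideanSpace ℝ (Fin n) → ℂ} (hf : Integrable f) :
    Continuous (𝓕⁻ f) := by
  have : 𝓕⁻ f = fun w => 𝓕 f (-w) := funext fun w => Real.fourierInv_eq_fourier_neg f w
  rw [this]
  exact (Real.continuous_fourier hf).comp continuous_neg

theorem integrable_exp_neg_mul_sq_two_pi_norm {R : ℝ} (hR : 0 < R) :
    Integrable fun ξ : EuclideanSpace ℝ (Fin n) => Real.exp (-(R * (2 * Real.pi * ‖ξ‖) ^ 2)) := by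
  have h := GaussianFourier.integral_rexp_neg_mul_sq_norm (V := EuclideanSpace ℝ (Fin n))
    (b := R * (2 * Real.pi) ^ 2) (by positivity)
  have h' : Integrable fun ξ : EuclideanSpace ℝ (Fin n) =>
      Real.exp (-(R * (2 * Real.pi) ^ 2) * ‖ξ‖ ^ 2) := by
    refine Integrable.of_integral_ne_zero ?_
    rw [h]
    positivity
  refine h'.congr (Eventually.of_forall fun ξ => ?_)
  simp only [mul_pow]
  congr 1
  ring

theorem gaussKernel_le (hρ : 0 < ρ) {r : ℝ} (hr : ρ ≤ r) (x : EuclideanSpace ℝ (Fin n)) :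
    gaussKernel r x ≤ (4 * Real.pi * ρ) ^ (-((n : ℝ) / 2)) := by
  have h1 : (4 * Real.pi * r) ^ (-((n : ℝ) / 2)) ≤ (4 * Real.pi * ρ) ^ (-((n : ℝ) / 2)) := by
    refine Real.rpow_le_rpow_of_nonpos (by positivity) (by gcongr) ?_
    have : (0 : ℝ) ≤ n := n.cast_nonneg
    linarith
  have hr0 : 0 < r := hρ.trans_le hr
  have h2 : Real.exp (-(4 * r)⁻¹ * ‖x‖ ^ 2) ≤ 1 := by
    rw [Real.exp_le_one_iff, neg_mul, neg_nonpos]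
    positivity
  unfold gaussKernel
  nlinarith [Real.rpow_nonneg (x := 4 * Real.pi * r) (by positivity) (-((n : ℝ) / 2))]

/-- The density of the mixture of centred Gaussians with weights `p` and parameters `R`. -/
noncomputable def gaussMixture {n : ℕ} (p R : ℕ → ℝ) (x : EuclideanSpace ℝ (Fin n)) : ℝ :=
  ∑' k, p k * gaussKernel (R k) x

theorem norm_mul_gaussKernel_le (hp : ∀ k, 0 ≤ p k) (hρ : 0 < ρ) (hR : ∀ k, ρ ≤ R k) (k : ℕ)
    (x : EuclideanSpace ℝ (Fin n)) :
    ‖p k * gaussKernel (R k) x‖ ≤ p k * (4 * Real.pi * ρ) ^ (-((n : ℝ) / 2)) := by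
  rw [Real.norm_of_nonneg (mul_nonneg (hp k) (gaussKernel_nonneg (hρ.trans_le (hR k)) x))]
  exact mul_le_mul_of_nonneg_left (gaussKernel_le hρ (hR k) x) (hp k)

theorem summable_mul_gaussKernel (hp : ∀ k, 0 ≤ p k) (hps : Summable p) (hρ : 0 < ρ)
    (hR : ∀ k, ρ ≤ R k) (x : EuclideanSpace ℝ (Fin n)) :
    Summable fun k => p k * gaussKernel (R k) x :=
  (hps.mul_right _).of_norm_bounded fun k => norm_mul_gaussKernel_le hp hρ hR k x

theorem continuous_gaussMixture (hp : ∀ k, 0 ≤ p k) (hps : Summable p) (hρ : 0 < ρ)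
    (hR : ∀ k, ρ ≤ R k) : Continuous (gaussMixture (n := n) p R) :=
  continuous_tsum (fun _ => continuous_const.mul continuous_gaussKernel) (hps.mul_right _)
    (fun k x => norm_mul_gaussKernel_le hp hρ hR k x)

theorem lintegral_enorm_gaussMixture_le (hp : ∀ k, 0 ≤ p k) (hps : Summable p) (hρ : 0 < ρ)
    (hR : ∀ k, ρ ≤ R k) :
    ∫⁻ x : EuclideanSpace ℝ (Fin n), ‖gaussMixture p R x‖ₑ ≤ ENNReal.ofReal (∑' k, p k) := by
  calc ∫⁻ x : EuclideanSpace ℝ (Fin n), ‖gaussMixture p R x‖ₑ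
      ≤ ∫⁻ x : EuclideanSpace ℝ (Fin n), ∑' k, ‖p k * gaussKernel (R k) x‖ₑ :=
        lintegral_mono fun x => enorm_tsum_le_tsum_enorm
    _ = ∑' k, ∫⁻ x : EuclideanSpace ℝ (Fin n), ‖p k * gaussKernel (R k) x‖ₑ :=
        lintegral_tsum fun k =>
          (continuous_const.mul continuous_gaussKernel).enorm.measurable.aemeasurable
    _ = ∑' k, ENNReal.ofReal (p k) := by
        refine tsum_congr fun k => ?_
        simp only [enorm_mul]
        rw [lintegral_const_mul' _ _ enorm_ne_top, lintegral_gaussKernel (hρ.trans_le (hR k)),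
          mul_one, Real.enorm_of_nonneg (hp k)]
    _ = ENNReal.ofReal (∑' k, p k) := (ENNReal.ofReal_tsum_of_nonneg hp hps).symm

theorem lintegral_enorm_gaussMixture_comp_add_sub_le (hp : ∀ k, 0 ≤ p k) (hps : Summable p)
    (hρ : 0 < ρ) (hR : ∀ k, ρ ≤ R k) {K : ℝ} (hK : ∀ S : Finset ℕ, ∑ k ∈ S, p k / √(R k) ≤ K)
    (h : EuclideanSpace ℝ (Fin n)) :
    ∫⁻ x, ‖gaussMixture p R (x + h) - gaussMixture p R x‖ₑ
      ≤ ENNReal.ofReal (2 ^ ((n : ℝ) / 2) * ‖h‖ * K) := by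
  have hnn : ∀ k, 0 ≤ p k / √(R k) := fun k => div_nonneg (hp k) (Real.sqrt_nonneg _)
  have hsm := summable_of_sum_le hnn hK
  calc ∫⁻ x, ‖gaussMixture p R (x + h) - gaussMixture p R x‖ₑ
      ≤ ∫⁻ x, ∑' k, ‖p k * (gaussKernel (R k) (x + h) - gaussKernel (R k) x)‖ₑ := by
        refine lintegral_mono fun x => ?_
        rw [gaussMixture, gaussMixture, ← (summable_mul_gaussKernel hp hps hρ hR _).tsum_sub
          (summable_mul_gaussKernel hp hps hρ hR _)]
        simp only [← mul_sub]
        exact enorm_tsum_le_tsum_enorm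
    _ = ∑' k, ∫⁻ x, ‖p k * (gaussKernel (R k) (x + h) - gaussKernel (R k) x)‖ₑ := by
        refine lintegral_tsum fun k => Measurable.aemeasurable (Continuous.measurable ?_)
        have := continuous_gaussKernel (n := n) (r := R k)
        fun_prop
    _ ≤ ∑' k, ENNReal.ofReal (2 ^ ((n : ℝ) / 2) * ‖h‖ * (p k / √(R k))) := by
        refine ENNReal.tsum_le_tsum fun k => ?_
        simp only [enorm_mul]
        rw [lintegral_const_mul' _ _ enorm_ne_top, Real.enorm_of_nonneg (hp k)]
        refine (mul_le_mul_right (lintegral_enorm_gaussKernel_comp_add_sub_le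
          (hρ.trans_le (hR k)) h) _).trans_eq ?_
        rw [← ENNReal.ofReal_mul (hp k)]
        congr 1
        ring
    _ = ENNReal.ofReal (2 ^ ((n : ℝ) / 2) * ‖h‖ * ∑' k, p k / √(R k)) := by
        rw [← tsum_mul_left, ENNReal.ofReal_tsum_of_nonneg _ (hsm.mul_left _)]
        intro k
        have := hnn k
        positivity
    _ ≤ ENNReal.ofReal (2 ^ ((n : ℝ) / 2) * ‖h‖ * K) := by
        refine ENNReal.ofReal_le_ofReal ?_
        gcongr
        exact hsm.tsum_le_of_sum_le hK

/-- Sum and integral commute because the Gaussian with the smallest parameter `ρ` dominates all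
terms. -/
theorem fourierInv_tsum_exp (hp : ∀ k, 0 ≤ p k) (hps : Summable p) (hρ : 0 < ρ)
    (hR : ∀ k, ρ ≤ R k) (x : EuclideanSpace ℝ (Fin n)) :
    𝓕⁻ (fun ξ : EuclideanSpace ℝ (Fin n) =>
      ((∑' k, p k * Real.exp (-(R k * (2 * Real.pi * ‖ξ‖) ^ 2)) : ℝ) : ℂ)) x
      = (gaussMixture p R x : ℂ) := by
  have hterm : ∀ k, 𝓕⁻ (fun ξ : EuclideanSpace ℝ (Fin n) =>
      ((p k * Real.exp (-(R k * (2 * Real.pi * ‖ξ‖) ^ 2)) : ℝ) : ℂ)) x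
      = ((p k * gaussKernel (R k) x : ℝ) : ℂ) := by
    intro k
    rw [Complex.ofReal_mul, ← fourierInv_exp_neg_mul_sq (hρ.trans_le (hR k)),
      Real.fourierInv_eq', Real.fourierInv_eq', ← integral_const_mul]
    congr 1
    ext ξ
    simp only [smul_eq_mul, Complex.ofReal_mul]
    ring
  have hint : ∀ k, Integrable fun ξ : EuclideanSpace ℝ (Fin n) =>
      ((p k * Real.exp (-(R k * (2 * Real.pi * ‖ξ‖) ^ 2)) : ℝ) : ℂ) := fun k =>
    ((integrable_exp_neg_mul_sq_two_pi_norm (hρ.trans_le (hR k))).const_mul (p k)).ofReal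
  have hnorm : ∀ k (ξ : EuclideanSpace ℝ (Fin n)),
      ‖((p k * Real.exp (-(R k * (2 * Real.pi * ‖ξ‖) ^ 2)) : ℝ) : ℂ)‖
        ≤ p k * Real.exp (-(ρ * (2 * Real.pi * ‖ξ‖) ^ 2)) := by
    intro k ξ
    rw [Complex.norm_real, Real.norm_of_nonneg (mul_nonneg (hp k) (Real.exp_pos _).le)]
    have := hp k
    have := hR k
    gcongr
  have hs := hasSum_integral_of_summable_integral_norm (μ := volume)
    (F := fun k (ξ : EuclideanSpace ℝ (Fin n)) => Real.fourierChar (inner ℝ ξ x) •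
      ((p k * Real.exp (-(R k * (2 * Real.pi * ‖ξ‖) ^ 2)) : ℝ) : ℂ)) ?_ ?_
  · simp only [← Real.fourierInv_eq, hterm] at hs
    have h2 : HasSum (fun k => ((p k * gaussKernel (R k) x : ℝ) : ℂ)) (gaussMixture p R x : ℂ) :=
      Complex.hasSum_ofReal.2 (summable_mul_gaussKernel hp hps hρ hR x).hasSum
    rw [← hs.unique h2, Real.fourierInv_eq]
    congr 1
    ext ξ
    simp only [Complex.ofReal_tsum, Circle.smul_def, smul_eq_mul, tsum_mul_left]
  · intro k
    have := (Real.fourierIntegral_convergent_iff (-x)).2 (hint k)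
    simpa using this
  · simp only [Circle.norm_smul]
    refine (hps.mul_right (∫ ξ : EuclideanSpace ℝ (Fin n),
      Real.exp (-(ρ * (2 * Real.pi * ‖ξ‖) ^ 2)))).of_nonneg_of_le
      (fun k => integral_nonneg fun _ => norm_nonneg _) fun k => ?_
    rw [← integral_const_mul]
    exact integral_mono (hint k).norm ((integrable_exp_neg_mul_sq_two_pi_norm hρ).const_mul _) (hnorm k)

end mixture

/-! ### The fractional heat kernel -/

/-- Merges a bound near the origin and one at infinity into a majorant integrable for `q > n`; the
factor `2^q` comes from `1 + x ≤ 2 max(1, x)`. -/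
theorem le_mul_one_add_rpow_neg {x y q K₀ K₁ : ℝ} (hx : 0 < x) (hq : 0 ≤ q) (hy : 0 ≤ y)
    (h₀ : y ≤ K₀) (h₁ : x ^ q * y ≤ K₁) : y ≤ (K₀ + K₁) * 2 ^ q * (1 + x) ^ (-q) := by
  have hK₀ : 0 ≤ K₀ := hy.trans h₀
  have hK₁ : 0 ≤ K₁ := le_trans (by positivity) h₁
  rw [Real.rpow_neg (by positivity), ← div_eq_mul_inv, le_div_iff₀ (by positivity)]
  rcases le_total x 1 with h | h
  · have h2 : (1 + x) ^ q ≤ 2 ^ q := Real.rpow_le_rpow (by positivity) (by linarith) hq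
    exact mul_le_mul (by linarith) h2 (by positivity) (by positivity)
  · have h2 : (1 + x) ^ q ≤ 2 ^ q * x ^ q := by
      rw [← Real.mul_rpow (by norm_num) hx.le]
      exact Real.rpow_le_rpow (by positivity) (by linarith) hq
    calc y * (1 + x) ^ q ≤ y * (2 ^ q * x ^ q) := mul_le_mul_of_nonneg_left h2 hy
      _ = x ^ q * y * 2 ^ q := by ring
      _ ≤ (K₀ + K₁) * 2 ^ q := by
          refine mul_le_mul_of_nonneg_right (by linarith) (by positivity)

section kernel

variable {n : ℕ} {s t : ℝ}

theorem integrable_const_mul_one_add_norm_smul {a : ℝ} (ha : a ≠ 0) (C : ℝ) :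
    Integrable fun ξ : EuclideanSpace ℝ (Fin n) => C * (1 + ‖a • ξ‖) ^ (-((n : ℝ) + 1)) := by
  have h : Integrable fun ξ : EuclideanSpace ℝ (Fin n) => (1 + ‖ξ‖) ^ (-((n : ℝ) + 1)) :=
    integrable_one_add_norm (by simp)
  exact (h.comp_smul ha).const_mul C

theorem ae_ne_zero_euclideanSpace (hn : 1 ≤ n) :
    ∀ᵐ ξ : EuclideanSpace ℝ (Fin n), ξ ≠ 0 := by
  have : Nonempty (Fin n) := ⟨⟨0, hn⟩⟩
  exact Measure.ae_ne volume 0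

theorem fracLaplacianSymbol_nonneg (ξ : EuclideanSpace ℝ (Fin n)) :
    0 ≤ fracLaplacianSymbol s ξ := by
  unfold fracLaplacianSymbol
  positivity

theorem continuous_fracLaplacianSymbol (hs0 : 0 < s) :
    Continuous (fracLaplacianSymbol (n := n) s) := by
  unfold fracLaplacianSymbol
  exact (by fun_prop : Continuous fun ξ : EuclideanSpace ℝ (Fin n) => 2 * Real.pi * ‖ξ‖).rpow_const
    fun _ => Or.inr (by positivity)

theorem mul_fracLaplacianSymbol (hs0 : 0 < s) (ht : 0 < t) (ξ : EuclideanSpace ℝ (Fin n)) :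
    t * fracLaplacianSymbol s ξ = fracLaplacianSymbol s (t ^ (1 / (2 * s)) • ξ) := by
  unfold fracLaplacianSymbol
  rw [norm_smul, Real.norm_of_nonneg (by positivity),
    show 2 * Real.pi * (t ^ (1 / (2 * s)) * ‖ξ‖) = t ^ (1 / (2 * s)) * (2 * Real.pi * ‖ξ‖) by ring,
    Real.mul_rpow (x := t ^ (1 / (2 * s))) (by positivity) (by positivity), ← Real.rpow_mul ht.le,
    one_div_mul_cancel (by positivity), Real.rpow_one]

/-- The Fourier transform `exp (-t |·|^{2s})` of the fractional heat kernel. -/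
noncomputable def fracHeatMultiplier (s t : ℝ) (ξ : EuclideanSpace ℝ (Fin n)) : ℂ :=
  (Real.exp (-t * fracLaplacianSymbol s ξ) : ℂ)

theorem fracHeatKernel_eq (s t : ℝ) (x : EuclideanSpace ℝ (Fin n)) :
    fracHeatKernel s t x = (𝓕⁻ (fracHeatMultiplier (n := n) s t) x).re := rfl

theorem norm_fracHeatMultiplier (ξ : EuclideanSpace ℝ (Fin n)) :
    ‖fracHeatMultiplier s t ξ‖ = Real.exp (-t * fracLaplacianSymbol s ξ) := by
  rw [fracHeatMultiplier, Complex.norm_real, Real.norm_of_nonneg (Real.exp_pos _).le]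

theorem continuous_fracHeatMultiplier (hs0 : 0 < s) :
    Continuous (fracHeatMultiplier (n := n) s t) := by
  have := continuous_fracLaplacianSymbol (n := n) hs0
  unfold fracHeatMultiplier
  fun_prop

theorem fracHeatMultiplier_eq_one_smul (hs0 : 0 < s) (ht : 0 < t) (ξ : EuclideanSpace ℝ (Fin n)) :
    fracHeatMultiplier s t ξ = fracHeatMultiplier s 1 (t ^ (1 / (2 * s)) • ξ) := by
  simp only [fracHeatMultiplier, neg_mul, one_mul, mul_fracLaplacianSymbol hs0 ht]

theorem integrable_norm_pow_mul_fracHeatMultiplier (hn : 1 ≤ n) (hs0 : 0 < s) (ht : 0 < t) (k : ℕ) :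
    Integrable fun ξ : EuclideanSpace ℝ (Fin n) => ‖ξ‖ ^ k * ‖fracHeatMultiplier s t ξ‖ := by
  set a : ℝ := t ^ (1 / (2 * s)) * (2 * Real.pi) with ha
  have ha0 : 0 < a := by positivity
  obtain ⟨K₀, hK₀⟩ := exists_forall_rpow_mul_exp_neg_le k
    (c := 1) (s := 2 * s) one_pos (by positivity) k.cast_nonneg
  obtain ⟨K₁, hK₁⟩ := exists_forall_rpow_mul_exp_neg_le (n + 1 + k)
    (c := 1) (s := 2 * s) one_pos (by positivity) (by positivity)
  have hc : Continuous fun ξ : EuclideanSpace ℝ (Fin n) => ‖ξ‖ ^ k * ‖fracHeatMultiplier s t ξ‖ := by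
    have := continuous_fracHeatMultiplier (n := n) (s := s) (t := t) hs0
    fun_prop
  refine (integrable_const_mul_one_add_norm_smul (n := n) ha0.ne'
    ((a ^ k)⁻¹ * ((K₀ + K₁) * 2 ^ ((n : ℝ) + 1)))).mono' hc.aestronglyMeasurable ?_
  filter_upwards [ae_ne_zero_euclideanSpace hn] with ξ hξ
  set x := ‖a • ξ‖ with hx
  have hx0 : 0 < x := norm_pos_iff.2 (smul_ne_zero ha0.ne' hξ)
  have hxξ : ‖ξ‖ = x / a := by
    rw [hx, norm_smul, Real.norm_of_nonneg ha0.le]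
    field_simp
  have hm : ‖fracHeatMultiplier s t ξ‖ = Real.exp (-1 * x ^ (2 * s)) := by
    rw [norm_fracHeatMultiplier, neg_mul, mul_fracLaplacianSymbol hs0 ht, fracLaplacianSymbol,
      hx, ha, neg_one_mul, norm_smul, norm_smul, norm_mul, Real.norm_of_nonneg (r := 2 * Real.pi) (by positivity)]
    congr 3
    ring
  have key := le_mul_one_add_rpow_neg (y := x ^ (k : ℝ) * Real.exp (-1 * x ^ (2 * s)))
    (q := (n : ℝ) + 1) (K₁ := K₁) hx0 (by positivity) (by positivity) (hK₀ x hx0.le)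
    (by rw [← mul_assoc, ← Real.rpow_add hx0]; exact hK₁ x hx0.le)
  rw [Real.norm_of_nonneg (by positivity), hm, hxξ, div_pow]
  rw [Real.rpow_natCast] at key
  calc x ^ k / a ^ k * Real.exp (-1 * x ^ (2 * s))
      = (a ^ k)⁻¹ * (x ^ k * Real.exp (-1 * x ^ (2 * s))) := by ring
    _ ≤ (a ^ k)⁻¹ * ((K₀ + K₁) * 2 ^ ((n : ℝ) + 1) * (1 + x) ^ (-((n : ℝ) + 1))) :=
        mul_le_mul_of_nonneg_left key (by positivity)
    _ = _ := by ring

theorem integrable_fracHeatMultiplier (hn : 1 ≤ n) (hs0 : 0 < s) (ht : 0 < t) :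
    Integrable (fracHeatMultiplier (n := n) s t) := by
  rw [← integrable_norm_iff (continuous_fracHeatMultiplier hs0).aestronglyMeasurable]
  simpa using integrable_norm_pow_mul_fracHeatMultiplier (n := n) hn hs0 ht 0

/-- The kernel is a pointwise limit of Gaussian mixtures with uniform `L¹` bounds. -/
theorem exists_tendsto_fracHeatKernel (hn : 1 ≤ n) (hs0 : 0 < s) (hs1 : s < 1) :
    ∃ C : ℝ, ∀ t : ℝ, 0 < t → ∃ P : ℕ → EuclideanSpace ℝ (Fin n) → ℝ,
      (∀ m, Continuous (P m)) ∧
      (∀ x, Tendsto (fun m => (P m x : ℂ)) atTop (𝓝 (𝓕⁻ (fracHeatMultiplier s t) x))) ∧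
      (∀ m, ∫⁻ x, ‖P m x‖ₑ ≤ 1) ∧
      (∀ m h, ∫⁻ x, ‖P m (x + h) - P m x‖ₑ ≤ ENNReal.ofReal (C * ‖h‖ * t ^ (-(1 / (2 * s))))) := by
  obtain ⟨p, r, ρ, F, hp, hρ, hr, hps, hp1, hF, hlim, hdec, K, hK⟩ :=
    exists_discrete_mixtures hs0 hs1
  refine ⟨2 ^ ((n : ℝ) / 2) * ((1 + K) / 2), fun t ht => ?_⟩
  have hts : 0 < t ^ (1 / s) := by positivity
  have hR : ∀ m k, ρ m * t ^ (1 / s) ≤ r m k * t ^ (1 / s) := fun m k =>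
    mul_le_mul_of_nonneg_right (hr m k) hts.le
  have hρ' : ∀ m, 0 < ρ m * t ^ (1 / s) := fun m => mul_pos (hρ m) hts
  have hr0 : ∀ m k, 0 < r m k := fun m k => (hρ m).trans_le (hr m k)
  -- Scaling the parameters by `t^{1/s}` makes the Laplace variable `l = t^{1/s}(2π‖ξ‖)²`, for which
  -- `exp(-l^s)` is the multiplier at time `t`.
  refine ⟨fun m => gaussMixture (p m) fun k => r m k * t ^ (1 / s), fun m =>
    continuous_gaussMixture (hp m) (hps m) (hρ' m) (hR m), fun x => ?_, fun m => ?_, fun m h => ?_⟩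
  · set a : ℝ := t ^ (1 / (2 * s)) * (2 * Real.pi) with ha
    have ha0 : 0 < a := by positivity
    have hts2 : t ^ (1 / s) = (t ^ (1 / (2 * s))) ^ 2 := by
      rw [← Real.rpow_mul_natCast ht.le]
      congr 1
      push_cast
      field_simp
    have hl : ∀ ξ : EuclideanSpace ℝ (Fin n), t ^ (1 / s) * (2 * Real.pi * ‖ξ‖) ^ 2
        = ‖a • ξ‖ ^ 2 := by
      intro ξ
      rw [norm_smul, Real.norm_of_nonneg ha0.le, ha, hts2]
      ring
    have hval : ∀ m (ξ : EuclideanSpace ℝ (Fin n)), ξ ≠ 0 →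
        ∑' k, p m k * Real.exp (-(r m k * t ^ (1 / s) * (2 * Real.pi * ‖ξ‖) ^ 2))
          = F m (‖a • ξ‖ ^ 2) := by
      intro m ξ hξ
      have h0 : 0 < ‖a • ξ‖ := norm_pos_iff.2 (smul_ne_zero ha0.ne' hξ)
      rw [← (hF m (‖a • ξ‖ ^ 2) (by positivity)).tsum_eq]
      refine tsum_congr fun k => ?_
      rw [mul_assoc, hl]
    obtain ⟨K₀, hK₀⟩ := hdec 0 le_rfl
    -- As `l = ‖a • ξ‖²`, this exponent gives decay of order `n + 1` in `‖a • ξ‖`, enough for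
    -- integrability.
    obtain ⟨K₁, hK₁⟩ := hdec (((n : ℝ) + 1) / 2) (by positivity)
    have hFnn : ∀ m l, 0 < l → 0 ≤ F m l := fun m l hl =>
      (hF m l hl).nonneg fun k => mul_nonneg (hp m k) (Real.exp_pos _).le
    have hbound : ∀ m (ξ : EuclideanSpace ℝ (Fin n)), ξ ≠ 0 → F m (‖a • ξ‖ ^ 2) ≤
        (K₀ + K₁) * 2 ^ ((n : ℝ) + 1) * (1 + ‖a • ξ‖) ^ (-((n : ℝ) + 1)) := by
      intro m ξ hξ
      have h0 : 0 < ‖a • ξ‖ := norm_pos_iff.2 (smul_ne_zero ha0.ne' hξ)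
      refine le_mul_one_add_rpow_neg h0 (by positivity) (hFnn m _ (by positivity)) ?_ ?_
      · simpa using hK₀ m (‖a • ξ‖ ^ 2) (by positivity)
      · have h := hK₁ m (‖a • ξ‖ ^ 2) (by positivity)
        rwa [← Real.rpow_natCast_mul h0.le, Nat.cast_ofNat, mul_div_cancel₀ _ two_ne_zero] at h
    simp only [← fourierInv_tsum_exp (hp _) (hps _) (hρ' _) (hR _), Real.fourierInv_eq]
    refine tendsto_integral_of_dominated_convergence
      (fun ξ => (K₀ + K₁) * 2 ^ ((n : ℝ) + 1) * (1 + ‖a • ξ‖) ^ (-((n : ℝ) + 1))) (fun m => ?_)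
      (integrable_const_mul_one_add_norm_smul ha0.ne' _) (fun m => ?_) ?_
    · refine AEStronglyMeasurable.smul (Continuous.aestronglyMeasurable ?_) ?_
      · exact continuous_subtype_val.comp (Real.continuous_fourierChar.comp
          (by fun_prop : Continuous fun ξ => inner ℝ ξ x))
      · refine (Complex.continuous_ofReal.comp (continuous_tsum (u := p m) (fun k => by fun_prop)
          (hps m) fun k ξ => ?_)).aestronglyMeasurable
        rw [Real.norm_of_nonneg (mul_nonneg (hp m k) (Real.exp_pos _).le)]
        refine mul_le_of_le_one_right (hp m k) ?_
        rw [Real.exp_le_one_iff, neg_nonpos]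
        have := hr0 m k
        positivity
    · filter_upwards [ae_ne_zero_euclideanSpace hn] with ξ hξ
      have h0 : 0 < ‖a • ξ‖ := norm_pos_iff.2 (smul_ne_zero ha0.ne' hξ)
      rw [Circle.norm_smul, hval m ξ hξ, Complex.norm_real,
        Real.norm_of_nonneg (hFnn m _ (by positivity))]
      exact hbound m ξ hξ
    · filter_upwards [ae_ne_zero_euclideanSpace hn] with ξ hξ
      have h0 : 0 < ‖a • ξ‖ := norm_pos_iff.2 (smul_ne_zero ha0.ne' hξ)
      simp only [hval _ ξ hξ]
      refine Tendsto.const_smul ?_ _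
      have h := hlim (‖a • ξ‖ ^ 2) (by positivity)
      have he : Real.exp (-(‖a • ξ‖ ^ 2) ^ s) = Real.exp (-t * fracLaplacianSymbol s ξ) := by
        rw [neg_mul, mul_fracLaplacianSymbol hs0 ht, fracLaplacianSymbol, ← Real.rpow_natCast_mul h0.le,
          ha, norm_smul, norm_smul, norm_mul, Real.norm_of_nonneg (r := 2 * Real.pi) (by positivity)]
        congr 3
        ring
      rw [he] at h
      exact (Complex.continuous_ofReal.tendsto _).comp h
  · refine (lintegral_enorm_gaussMixture_le (hp m) (hps m) (hρ' m) (hR m)).trans ?_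
    simpa using hp1 m
  · have hS : ∀ S : Finset ℕ, ∑ k ∈ S, p m k / √(r m k * t ^ (1 / s))
        ≤ (1 + K) / 2 * t ^ (-(1 / (2 * s))) := by
      intro S
      have hst : √(t ^ (1 / s)) = t ^ (1 / (2 * s)) := by
        rw [Real.sqrt_eq_rpow, ← Real.rpow_mul ht.le]
        congr 1
        field_simp
      have h1 : ∀ k ∈ S, p m k / √(r m k * t ^ (1 / s))
          ≤ (p m k + p m k / r m k) / 2 * t ^ (-(1 / (2 * s))) := by
        intro k _
        rw [Real.sqrt_mul (hr0 m k).le, hst, Real.rpow_neg ht.le, ← div_div, ← div_eq_mul_inv]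
        refine div_le_div_of_nonneg_right ?_ (by positivity)
        have h2 : 0 < √(r m k) := Real.sqrt_pos.2 (hr0 m k)
        -- The arithmetic-geometric inequality reduces the moment of order `-1/2` to the mass and
        -- the moment of order `-1`.
        have h3 : (√(r m k))⁻¹ ≤ (1 + (r m k)⁻¹) / 2 := by
          have : (r m k)⁻¹ = (√(r m k))⁻¹ ^ 2 := by rw [inv_pow, Real.sq_sqrt (hr0 m k).le]
          rw [this]
          nlinarith [sq_nonneg ((√(r m k))⁻¹ - 1)]
        have := mul_le_mul_of_nonneg_left h3 (hp m k)
        calc p m k / √(r m k) ≤ p m k * ((1 + (r m k)⁻¹) / 2) := this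
          _ = _ := by ring
      refine (Finset.sum_le_sum h1).trans ?_
      rw [← Finset.sum_mul, ← Finset.sum_div, Finset.sum_add_distrib]
      have h4 := ((hps m).sum_le_tsum S fun k _ => hp m k).trans (hp1 m)
      have h5 := ((hK m).1.sum_le_tsum S fun k _ => div_nonneg (hp m k) (hr0 m k).le).trans (hK m).2
      gcongr
    refine (lintegral_enorm_gaussMixture_comp_add_sub_le (hp m) (hps m) (hρ' m) (hR m) hS h).trans_eq ?_
    congr 1
    ring

/-- The inverse transform is real as a limit of real Gaussian mixtures. -/
theorem ofReal_fracHeatKernel (hn : 1 ≤ n) (hs0 : 0 < s) (hs1 : s < 1) (ht : 0 < t)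
    (x : EuclideanSpace ℝ (Fin n)) :
    (fracHeatKernel s t x : ℂ) = 𝓕⁻ (fracHeatMultiplier s t) x := by
  obtain ⟨C, hC⟩ := exists_tendsto_fracHeatKernel (n := n) hn hs0 hs1
  obtain ⟨P, -, hP, -⟩ := hC t ht
  have him := (Complex.continuous_im.tendsto _).comp (hP x)
  have h0 : (𝓕⁻ (fracHeatMultiplier s t) x).im = 0 := by
    refine tendsto_nhds_unique him ?_
    simp [Function.comp_def]
  refine Complex.ext ?_ ?_
  · simp [fracHeatKernel_eq]
  · simp [h0]

theorem continuous_fracHeatKernel (hn : 1 ≤ n) (hs0 : 0 < s) (ht : 0 < t) :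
    Continuous (fracHeatKernel (n := n) s t) :=
  Complex.continuous_re.comp
    (Real.continuous_fourierInv (integrable_fracHeatMultiplier hn hs0 ht))

/-- Fatou's lemma, in the form that carries the mixture bounds to the kernel. -/
theorem lintegral_enorm_le_of_forall_tendsto {α : Type*} [MeasurableSpace α] {μ : Measure α}
    {G : ℕ → α → ℝ} {f : α → ℝ} {C : ENNReal} (hG : ∀ m, AEStronglyMeasurable (G m) μ)
    (hlim : ∀ x, Tendsto (fun m => G m x) atTop (𝓝 (f x)))
    (hC : ∀ m, ∫⁻ x, ‖G m x‖ₑ ∂μ ≤ C) : ∫⁻ x, ‖f x‖ₑ ∂μ ≤ C := by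
  calc ∫⁻ x, ‖f x‖ₑ ∂μ = ∫⁻ x, liminf (fun m => ‖G m x‖ₑ) atTop ∂μ :=
        lintegral_congr fun x => (hlim x).enorm.liminf_eq.symm
    _ ≤ liminf (fun m => ∫⁻ x, ‖G m x‖ₑ ∂μ) atTop := lintegral_liminf_le' fun m => (hG m).enorm
    _ ≤ C := by
        refine (liminf_le_liminf (Eventually.of_forall hC)).trans_eq ?_
        exact liminf_const C

theorem integrable_fracHeatKernel (hn : 1 ≤ n) (hs0 : 0 < s) (hs1 : s < 1) (ht : 0 < t) :
    Integrable (fracHeatKernel (n := n) s t) := by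
  obtain ⟨C, hC⟩ := exists_tendsto_fracHeatKernel (n := n) hn hs0 hs1
  obtain ⟨P, hc, hP, h1, -⟩ := hC t ht
  refine ⟨(continuous_fracHeatKernel hn hs0 ht).aestronglyMeasurable, ?_⟩
  refine lt_of_le_of_lt (lintegral_enorm_le_of_forall_tendsto
    (fun m => (hc m).aestronglyMeasurable) (fun x => ?_) h1) ENNReal.one_lt_top
  simpa [Function.comp_def, fracHeatKernel_eq] using (Complex.continuous_re.tendsto _).comp (hP x)

theorem exists_lintegral_enorm_fracHeatKernel_comp_add_sub_le (hn : 1 ≤ n) (hs0 : 0 < s)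
    (hs1 : s < 1) :
    ∃ C : ℝ, 0 < C ∧ ∀ t : ℝ, 0 < t → ∀ h : EuclideanSpace ℝ (Fin n),
      ∫⁻ x, ‖fracHeatKernel s t (x + h) - fracHeatKernel s t x‖ₑ
        ≤ ENNReal.ofReal (C * ‖h‖ * t ^ (-(1 / (2 * s)))) := by
  obtain ⟨C, hC⟩ := exists_tendsto_fracHeatKernel (n := n) hn hs0 hs1
  refine ⟨max C 1, by positivity, fun t ht h => ?_⟩
  obtain ⟨P, hc, hP, -, h1⟩ := hC t ht
  have hre : ∀ x, Tendsto (fun m => P m x) atTop (𝓝 (fracHeatKernel s t x)) := fun x => by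
    simpa [Function.comp_def, fracHeatKernel_eq] using (Complex.continuous_re.tendsto _).comp (hP x)
  refine (lintegral_enorm_le_of_forall_tendsto (G := fun m x => P m (x + h) - P m x)
    (fun m => ?_) (fun x => (hre _).sub (hre _)) fun m => h1 m h).trans ?_
  · have := hc m
    exact Continuous.aestronglyMeasurable (by fun_prop)
  · refine ENNReal.ofReal_le_ofReal ?_
    gcongr
    exact le_max_left _ _

theorem fourier_fourierInv_eq_of_integrable {g : EuclideanSpace ℝ (Fin n) → ℂ} (hc : Continuous g)
    (hg : Integrable g) (hg' : Integrable (𝓕⁻ g)) : 𝓕 (𝓕⁻ g) = g := by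
  refine hc.fourier_fourierInv_eq hg ?_
  have h3 : 𝓕 g = fun x => 𝓕⁻ g (-x) :=
    funext fun x => by rw [Real.fourierInv_eq_fourier_neg, neg_neg]
  rw [h3]
  exact hg'.comp_neg

theorem fourier_fracHeatKernel (hn : 1 ≤ n) (hs0 : 0 < s) (hs1 : s < 1) (ht : 0 < t) :
    𝓕 (fun x : EuclideanSpace ℝ (Fin n) => (fracHeatKernel s t x : ℂ)) = fracHeatMultiplier s t := by
  have hint := integrable_fracHeatMultiplier (n := n) hn hs0 ht
  have h1 : (fun x : EuclideanSpace ℝ (Fin n) => (fracHeatKernel s t x : ℂ))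
      = 𝓕⁻ (fracHeatMultiplier s t) := funext fun x => ofReal_fracHeatKernel hn hs0 hs1 ht x
  have h2 : Integrable (𝓕⁻ (fracHeatMultiplier (n := n) s t)) := by
    rw [← h1]
    exact (integrable_fracHeatKernel hn hs0 hs1 ht).ofReal
  rw [h1]
  exact fourier_fourierInv_eq_of_integrable (continuous_fracHeatMultiplier hs0) hint h2

theorem integral_fracHeatKernel (hn : 1 ≤ n) (hs0 : 0 < s) (hs1 : s < 1) (ht : 0 < t) :
    ∫ x : EuclideanSpace ℝ (Fin n), fracHeatKernel s t x = 1 := by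
  have h := congrFun (fourier_fracHeatKernel (n := n) hn hs0 hs1 ht) 0
  have h0 : fracLaplacianSymbol s (0 : EuclideanSpace ℝ (Fin n)) = 0 := by
    simp [fracLaplacianSymbol, Real.zero_rpow, hs0.ne']
  rw [Real.fourier_eq', fracHeatMultiplier, h0] at h
  simp only [inner_zero_right, mul_zero, Complex.ofReal_zero, zero_mul, Complex.exp_zero,
    one_smul, Real.exp_zero, Complex.ofReal_one] at h
  rw [integral_complex_ofReal] at h
  exact_mod_cast h

end kernel

/-! ### Fourier multipliers against the fractional heat flow -/

section multiplier

variable {n : ℕ} {s t : ℝ}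

theorem norm_fourierChar_sub_one_le (θ : ℝ) :
    ‖(Real.fourierChar θ : ℂ) - 1‖ ≤ 2 * Real.pi * |θ| := by
  rw [Real.fourierChar_apply]
  have h := Real.norm_exp_I_mul_ofReal_sub_one_le (x := 2 * Real.pi * θ)
  rw [mul_comm Complex.I] at h
  refine h.trans_eq ?_
  rw [Real.norm_eq_abs, abs_mul, abs_of_pos Real.two_pi_pos]

theorem tendsto_mul_fourierChar_sub_one (θ : ℝ) :
    Tendsto (fun τ : ℝ => (τ : ℂ) * ((Real.fourierChar (τ⁻¹ * θ) : ℂ) - 1)) atTop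
      (𝓝 (2 * Real.pi * Complex.I * θ)) := by
  have hd : HasDerivAt (fun ε : ℝ => (Real.fourierChar (ε * θ) : ℂ)) (2 * Real.pi * Complex.I * θ) 0 := by
    have h1 : HasDerivAt (fun ε : ℝ => ε * θ) θ 0 := by
      simpa using (hasDerivAt_id (0 : ℝ)).mul_const θ
    have h2 := (Real.hasDerivAt_fourierChar (0 * θ)).scomp (0 : ℝ) h1
    convert! h2 using 1
    simp [mul_comm]
  have h3 := hd.tendsto_slope.comp (tendsto_inv_atTop_nhdsGT_zero.mono_right
    (nhdsWithin_mono _ fun x (hx : 0 < x) => hx.ne'))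
  refine h3.congr fun τ => ?_
  simp [slope_def_module]

theorem rpow_natCast_div_eq (ht : 0 ≤ t) (n : ℕ) (s : ℝ) :
    t ^ ((n : ℝ) / (2 * s)) = (t ^ (1 / (2 * s))) ^ n := by
  rw [← Real.rpow_mul_natCast ht]
  congr 1
  ring

theorem integrable_mul_fracHeatMultiplier (hn : 1 ≤ n) (hs0 : 0 < s) (ht : 0 < t)
    {A : EuclideanSpace ℝ (Fin n) → ℂ} (hA : Continuous A) {K : ℝ} (hK : ∀ ξ, ‖A ξ‖ ≤ K * ‖ξ‖) :
    Integrable fun ξ => A ξ * fracHeatMultiplier s t ξ := by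
  refine ((integrable_norm_pow_mul_fracHeatMultiplier (n := n) hn hs0 ht 1).const_mul K).mono'
    (hA.mul (continuous_fracHeatMultiplier hs0)).aestronglyMeasurable
    (Eventually.of_forall fun ξ => ?_)
  rw [norm_mul, pow_one, ← mul_assoc]
  exact mul_le_mul_of_nonneg_right (hK ξ) (norm_nonneg _)

/-- Self-similarity: the change of variable `ξ ↦ t^{1/2s} ξ` leaves time only in the argument of
`A`. -/
theorem pow_mul_fourierInv_mul_fracHeatMultiplier (hs0 : 0 < s) (ht : 0 < t)
    (A : EuclideanSpace ℝ (Fin n) → ℂ) (z : EuclideanSpace ℝ (Fin n)) :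
    ((t ^ ((n : ℝ) / (2 * s)) : ℝ) : ℂ) *
        𝓕⁻ (fun ξ => A ξ * fracHeatMultiplier s t ξ) (t ^ (1 / (2 * s)) • z)
      = 𝓕⁻ (fun ξ => A ((t ^ (1 / (2 * s)))⁻¹ • ξ) * fracHeatMultiplier s 1 ξ) z := by
  set τ : ℝ := t ^ (1 / (2 * s)) with hτ
  have hτ0 : 0 < τ := by positivity
  have h := Measure.integral_comp_smul (volume : Measure (EuclideanSpace ℝ (Fin n)))
    (fun ξ => Real.fourierChar (inner ℝ ξ z) • (A (τ⁻¹ • ξ) * fracHeatMultiplier s 1 ξ)) τ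
  rw [Real.fourierInv_eq, Real.fourierInv_eq, rpow_natCast_div_eq ht.le, ← hτ]
  have h2 : ∀ ξ : EuclideanSpace ℝ (Fin n), Real.fourierChar (inner ℝ (τ • ξ) z) •
      (A (τ⁻¹ • τ • ξ) * fracHeatMultiplier s 1 (τ • ξ))
      = Real.fourierChar (inner ℝ ξ (τ • z)) • (A ξ * fracHeatMultiplier s t ξ) := by
    intro ξ
    rw [inv_smul_smul₀ hτ0.ne', fracHeatMultiplier_eq_one_smul hs0 ht, inner_smul_left,
      inner_smul_right]
    rfl
  simp only [h2, finrank_euclideanSpace_fin] at h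
  rw [h, abs_of_nonneg (by positivity), Complex.real_smul, ← mul_assoc, ← Complex.ofReal_mul,
    mul_inv_cancel₀ (by positivity), Complex.ofReal_one, one_mul]

theorem norm_fourierInv_le (f : EuclideanSpace ℝ (Fin n) → ℂ) (x : EuclideanSpace ℝ (Fin n)) :
    ‖𝓕⁻ f x‖ ≤ ∫ ξ, ‖f ξ‖ := by
  rw [Real.fourierInv_eq]
  refine (norm_integral_le_integral_norm _).trans_eq ?_
  simp only [Circle.norm_smul]

theorem pow_mul_norm_fourierInv_mul_fracHeatMultiplier_le (hn : 1 ≤ n) (hs0 : 0 < s) (ht : 0 < t)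
    {A : EuclideanSpace ℝ (Fin n) → ℂ} {K : ℝ} (hK : ∀ ξ, ‖A ξ‖ ≤ K * ‖ξ‖)
    (x : EuclideanSpace ℝ (Fin n)) :
    t ^ ((n : ℝ) / (2 * s)) * ‖𝓕⁻ (fun ξ => A ξ * fracHeatMultiplier s t ξ) x‖
      ≤ K * (∫ ξ : EuclideanSpace ℝ (Fin n), ‖ξ‖ * ‖fracHeatMultiplier s 1 ξ‖) *
        t ^ (-(1 / (2 * s))) := by
  have hτ0 : 0 < t ^ (1 / (2 * s)) := by positivity
  have h := pow_mul_fourierInv_mul_fracHeatMultiplier hs0 ht A ((t ^ (1 / (2 * s)))⁻¹ • x)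
  rw [smul_inv_smul₀ hτ0.ne'] at h
  have hn' := congrArg norm h
  rw [norm_mul, Complex.norm_real, Real.norm_of_nonneg (by positivity)] at hn'
  rw [hn']
  refine (norm_fourierInv_le _ _).trans ?_
  have hint := integrable_norm_pow_mul_fracHeatMultiplier (n := n) hn hs0 one_pos 1
  simp only [pow_one] at hint
  rw [mul_right_comm, ← integral_const_mul]
  refine integral_mono_of_nonneg (Eventually.of_forall fun _ => norm_nonneg _)
    (hint.const_mul _) (Eventually.of_forall fun ξ => ?_)
  simp only [norm_mul]
  refine (mul_le_mul_of_nonneg_right (hK _) (norm_nonneg _)).trans_eq ?_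
  rw [norm_smul, norm_inv, Real.norm_of_nonneg hτ0.le, Real.rpow_neg ht.le]
  ring

/-- Were the inverse transform identically zero, inversion would make the multiplier vanish, yet it
is nonzero at `ξ = b`. -/
theorem exists_fourierInv_linear_ne_zero (hn : 1 ≤ n) (hs0 : 0 < s)
    {b : EuclideanSpace ℝ (Fin n)} (hb : b ≠ 0) :
    ∃ z, 𝓕⁻ (fun ξ : EuclideanSpace ℝ (Fin n) =>
      (2 * Real.pi * Complex.I * (inner ℝ b ξ : ℝ)) * fracHeatMultiplier s 1 ξ) z ≠ 0 := by
  by_contra! h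
  set L : EuclideanSpace ℝ (Fin n) → ℂ := fun ξ =>
    (2 * Real.pi * Complex.I * (inner ℝ b ξ : ℝ)) * fracHeatMultiplier s 1 ξ with hL
  have h0 : 𝓕⁻ L = 0 := funext h
  have hA : Continuous fun ξ : EuclideanSpace ℝ (Fin n) =>
      (2 * Real.pi * Complex.I * (inner ℝ b ξ : ℝ) : ℂ) := by fun_prop
  have hc : Continuous L := hA.mul (continuous_fracHeatMultiplier hs0)
  have hi : Integrable L := by
    refine integrable_mul_fracHeatMultiplier hn hs0 one_pos hA (K := 2 * Real.pi * ‖b‖) fun ξ => ?_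
    simp only [norm_mul, Complex.norm_real, Complex.norm_I, Complex.norm_ofNat, mul_one]
    rw [Real.norm_of_nonneg Real.pi_pos.le, mul_assoc _ ‖b‖]
    exact mul_le_mul_of_nonneg_left (norm_inner_le_norm b ξ) (by positivity)
  have h1 := fourier_fourierInv_eq_of_integrable hc hi (by rw [h0]; exact integrable_zero _ _ _)
  have h2 : L b = 0 := by
    rw [← h1, h0, Real.fourier_eq]
    simp
  have h3 : fracHeatMultiplier s 1 b ≠ 0 := by
    rw [fracHeatMultiplier]
    exact_mod_cast (Real.exp_pos _).ne'
  simp [hL, h3, hb, Real.pi_ne_zero] at h2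

/-- If the multiplier `A` behaves like `2πi⟨b, ξ⟩` at the origin, with `b ≠ 0`, then
`𝓕⁻ (A exp (-t |·|^{2s}))` decays exactly one power of `t^{1/2s}` faster than the kernel. -/
theorem exists_lower_bound_of_multiplier (hn : 1 ≤ n) (hs0 : 0 < s)
    {A : EuclideanSpace ℝ (Fin n) → ℂ} (hA : Continuous A) {K : ℝ} (hK : ∀ ξ, ‖A ξ‖ ≤ K * ‖ξ‖)
    {b : EuclideanSpace ℝ (Fin n)} (hb : b ≠ 0)
    (hlim : ∀ ξ, Tendsto (fun τ : ℝ => (τ : ℂ) * A (τ⁻¹ • ξ)) atTop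
      (𝓝 (2 * Real.pi * Complex.I * (inner ℝ b ξ : ℝ)))) :
    ∃ c > (0 : ℝ), ∃ T > (0 : ℝ), ∀ t : ℝ, T ≤ t → ∀ w : EuclideanSpace ℝ (Fin n) → ℝ,
      (∀ x, (w x : ℂ) = 𝓕⁻ (fun ξ => A ξ * fracHeatMultiplier s t ξ) x) → Integrable w →
      (∃ x, c * t ^ (-(1 / (2 * s))) ≤ t ^ ((n : ℝ) / (2 * s)) * |w x|) ∧
      ENNReal.ofReal (c * t ^ (-(1 / (2 * s)))) ≤ eLpNorm w 1 volume := by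
  obtain ⟨z, hz⟩ := exists_fourierInv_linear_ne_zero (n := n) (s := s) hn hs0 hb
  set Z := 𝓕⁻ (fun ξ : EuclideanSpace ℝ (Fin n) =>
      (2 * Real.pi * Complex.I * (inner ℝ b ξ : ℝ)) * fracHeatMultiplier s 1 ξ) z with hZ
  have hmcont := continuous_fracHeatMultiplier (n := n) (s := s) (t := 1) hs0
  have hint := integrable_norm_pow_mul_fracHeatMultiplier (n := n) hn hs0 one_pos 1
  simp only [pow_one] at hint
  -- Dominated convergence: `τ ‖A(τ⁻¹ξ)‖ ≤ K‖ξ‖` for every `τ > 0`, and the multiplier has a finite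
  -- first moment.
  have hsup : Tendsto (fun τ : ℝ =>
      (τ : ℂ) * 𝓕⁻ (fun ξ => A (τ⁻¹ • ξ) * fracHeatMultiplier s 1 ξ) z) atTop (𝓝 Z) := by
    simp only [hZ, Real.fourierInv_eq, ← integral_const_mul]
    refine tendsto_integral_filter_of_dominated_convergence
      (fun ξ => K * (‖ξ‖ * ‖fracHeatMultiplier s 1 ξ‖)) (Eventually.of_forall fun τ => ?_) ?_
      (hint.const_mul K) (Eventually.of_forall fun ξ => ?_)
    · refine Continuous.aestronglyMeasurable (continuous_const.mul (Continuous.smul ?_ ?_))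
      · exact continuous_subtype_val.comp (Real.continuous_fourierChar.comp
          (by fun_prop : Continuous fun ξ => inner ℝ ξ z))
      · exact (hA.comp (continuous_const_smul _)).mul hmcont
    · filter_upwards [eventually_gt_atTop 0] with τ hτ
      refine Eventually.of_forall fun ξ => ?_
      rw [norm_mul, Circle.norm_smul, norm_mul, Complex.norm_real, Real.norm_of_nonneg hτ.le]
      have h1 := hK (τ⁻¹ • ξ)
      rw [norm_smul, norm_inv, Real.norm_of_nonneg hτ.le] at h1
      have h2 : τ * ‖A (τ⁻¹ • ξ)‖ ≤ K * ‖ξ‖ := by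
        refine (mul_le_mul_of_nonneg_left h1 hτ.le).trans_eq ?_
        field_simp
      calc _ = (τ * ‖A (τ⁻¹ • ξ)‖) * ‖fracHeatMultiplier s 1 ξ‖ := by ring
        _ ≤ (K * ‖ξ‖) * ‖fracHeatMultiplier s 1 ξ‖ := by gcongr
        _ = _ := by ring
    · have h1 := ((hlim ξ).mul_const (fracHeatMultiplier s 1 ξ)).const_smul
        (Real.fourierChar (inner ℝ ξ z))
      refine h1.congr fun τ => ?_
      simp only [Circle.smul_def, smul_eq_mul]
      ring
  -- For the `L¹` bound, the Fourier transform is sampled at `τ⁻¹b`, where the first-order term is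
  -- proportional to `‖b‖²`.
  have hL1 : Tendsto (fun τ : ℝ => ‖(τ : ℂ) * A (τ⁻¹ • b)‖ * ‖fracHeatMultiplier s 1 b‖) atTop
      (𝓝 (‖(2 * Real.pi * Complex.I * (inner ℝ b b : ℝ) : ℂ)‖ * ‖fracHeatMultiplier s 1 b‖)) :=
    (hlim b).norm.mul_const _
  set c₁ := ‖(2 * Real.pi * Complex.I * (inner ℝ b b : ℝ) : ℂ)‖ * ‖fracHeatMultiplier s 1 b‖ with hc₁
  have hc₁0 : 0 < c₁ := by
    refine mul_pos (norm_pos_iff.2 ?_) (norm_pos_iff.2 ?_)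
    · simp [hb, Real.pi_ne_zero]
    · rw [fracHeatMultiplier]
      exact_mod_cast (Real.exp_pos _).ne'
  have hZ0 : 0 < ‖Z‖ := norm_pos_iff.2 hz
  -- Strictly below both limits, so both quantities eventually exceed `c`.
  set c := min ‖Z‖ c₁ / 2 with hc
  have hc0 : 0 < c := by positivity
  have hcZ : c < ‖Z‖ := by
    have := min_le_left ‖Z‖ c₁
    linarith
  have hcc₁ : c < c₁ := by
    have := min_le_right ‖Z‖ c₁
    linarith
  have hτlim : Tendsto (fun t : ℝ => t ^ (1 / (2 * s))) atTop atTop :=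
    tendsto_rpow_atTop (by positivity)
  have hev := hτlim.eventually ((hsup.norm.eventually (lt_mem_nhds hcZ)).and
    (hL1.eventually (lt_mem_nhds hcc₁)))
  obtain ⟨T, hT⟩ := eventually_atTop.1 hev
  refine ⟨c, hc0, max T 1, by positivity, fun t htT w hw hwi => ?_⟩
  have ht : 0 < t := lt_of_lt_of_le (by positivity) htT
  obtain ⟨h1, h2⟩ := hT t ((le_max_left _ _).trans htT)
  set τ := t ^ (1 / (2 * s)) with hτ
  have hτ0 : 0 < τ := by positivity
  have hneg : t ^ (-(1 / (2 * s))) = τ⁻¹ := Real.rpow_neg ht.le _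
  rw [hneg]
  refine ⟨⟨τ • z, ?_⟩, ?_⟩
  · have h3 := congrArg norm (pow_mul_fourierInv_mul_fracHeatMultiplier hs0 ht A z)
    rw [← hτ, ← hw, norm_mul, Complex.norm_real, Complex.norm_real,
      Real.norm_of_nonneg (by positivity), Real.norm_eq_abs] at h3
    rw [h3, ← div_eq_mul_inv, div_le_iff₀ hτ0, mul_comm]
    rw [norm_mul, Complex.norm_real, Real.norm_of_nonneg hτ0.le] at h1
    exact h1.le
  · have hg := integrable_mul_fracHeatMultiplier hn hs0 ht hA hK
    have hwc : (fun x => (w x : ℂ)) = 𝓕⁻ (fun ξ => A ξ * fracHeatMultiplier s t ξ) := funext hw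
    have hF := fourier_fourierInv_eq_of_integrable
      (g := fun ξ => A ξ * fracHeatMultiplier s t ξ) (hA.mul (continuous_fracHeatMultiplier hs0)) hg
      (by rw [← hwc]; exact hwi.ofReal)
    have h4 : 𝓕 (fun x => (w x : ℂ)) (τ⁻¹ • b) = A (τ⁻¹ • b) * fracHeatMultiplier s 1 b := by
      rw [hwc, hF]
      simp only
      rw [fracHeatMultiplier_eq_one_smul hs0 ht, ← hτ, smul_inv_smul₀ hτ0.ne']
    have h5 : ‖𝓕 (fun x => (w x : ℂ)) (τ⁻¹ • b)‖ ≤ ∫ x, ‖w x‖ := by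
      rw [Real.fourier_eq]
      refine (norm_integral_le_integral_norm _).trans_eq ?_
      simp only [Circle.norm_smul, Complex.norm_real]
    rw [eLpNorm_one_eq_lintegral_enorm, ← ofReal_integral_norm_eq_lintegral_enorm hwi]
    refine ENNReal.ofReal_le_ofReal (le_trans ?_ h5)
    rw [h4, ← div_eq_mul_inv, div_le_iff₀ hτ0, norm_mul]
    rw [norm_mul, Complex.norm_real, Real.norm_of_nonneg hτ0.le] at h2
    linarith

end multiplier

/-! ### The representation formula -/

/-- Translations act continuously and isometrically on `L¹`, so the distance from `f` to its
translate is continuous and at most `2‖f‖₁`. -/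
theorem exists_L1_translation_modulus {n : ℕ} {f : EuclideanSpace ℝ (Fin n) → ℝ}
    (hf : Integrable f) :
    ∃ ω : EuclideanSpace ℝ (Fin n) → ℝ, Continuous ω ∧ ω 0 = 0 ∧ (∀ y, 0 ≤ ω y) ∧
      (∃ B, ∀ y, ω y ≤ B) ∧ ∀ y, ∫⁻ x, ‖f (x - y) - f x‖ₑ = ENNReal.ofReal (ω y) := by
  have : Fact ((1 : ENNReal) ≠ ⊤) := ⟨ENNReal.one_ne_top⟩
  have hmem : MemLp f 1 volume := memLp_one_iff_integrable.2 hf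
  set F : Lp ℝ 1 (volume : Measure (EuclideanSpace ℝ (Fin n))) := hmem.toLp f with hF
  refine ⟨fun y => dist (DomAddAct.mk (-y) +ᵥ F) F, ?_, ?_, fun y => dist_nonneg,
    ⟨‖F‖ + ‖F‖, fun y => ?_⟩, fun y => ?_⟩
  · have h : Continuous fun y : EuclideanSpace ℝ (Fin n) => DomAddAct.mk (-y) +ᵥ F :=
      (DomAddAct.continuous_mk.comp continuous_neg).vadd continuous_const
    exact h.dist continuous_const
  · simp
  · dsimp only
    rw [dist_eq_norm]
    refine (norm_sub_le _ _).trans ?_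
    rw [DomAddAct.norm_vadd_Lp]
  · rw [← edist_dist, hF, DomAddAct.mk_vadd_toLp, Lp.edist_toLp_toLp, eLpNorm_one_eq_lintegral_enorm]
    refine lintegral_congr fun x => ?_
    simp [sub_eq_neg_add]

theorem MeasureTheory.Integrable.complex_ofReal {n : ℕ} {f : EuclideanSpace ℝ (Fin n) → ℝ}
    (hf : Integrable f) : Integrable fun x => (f x : ℂ) :=
  hf.ofReal

section evolution

variable {n : ℕ} {s t : ℝ} {u₀ : EuclideanSpace ℝ (Fin n) → ℝ}

theorem exists_norm_fracHeatKernel_le (s t : ℝ) :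
    ∃ B, ∀ x : EuclideanSpace ℝ (Fin n), ‖fracHeatKernel s t x‖ ≤ B :=
  ⟨_, fun x => (Complex.abs_re_le_norm _).trans (norm_fourierInv_le _ x)⟩

theorem integrable_fracHeatKernel_sub_mul (hn : 1 ≤ n) (hs0 : 0 < s) (ht : 0 < t)
    (hu : Integrable u₀) (x : EuclideanSpace ℝ (Fin n)) :
    Integrable fun y => fracHeatKernel s t (x - y) * u₀ y := by
  obtain ⟨B, hB⟩ := exists_norm_fracHeatKernel_le (n := n) s t
  refine hu.bdd_mul (c := B) ?_ (Eventually.of_forall fun y => hB _)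
  exact ((continuous_fracHeatKernel hn hs0 ht).comp (by fun_prop)).aestronglyMeasurable

theorem continuous_fracHeatEvolution (hn : 1 ≤ n) (hs0 : 0 < s) (ht : 0 < t)
    (hu : Integrable u₀) : Continuous (fracHeatEvolution s u₀ t) := by
  obtain ⟨B, hB⟩ := exists_norm_fracHeatKernel_le (n := n) s t
  refine continuous_of_dominated (bound := fun y => B * ‖u₀ y‖)
    (fun x => (integrable_fracHeatKernel_sub_mul hn hs0 ht hu x).aestronglyMeasurable)
    (fun x => Eventually.of_forall fun y => ?_) (hu.norm.const_mul B)
    (Eventually.of_forall fun y => ?_)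
  · rw [norm_mul]
    exact mul_le_mul_of_nonneg_right (hB _) (norm_nonneg _)
  · exact ((continuous_fracHeatKernel hn hs0 ht).comp (by fun_prop)).mul continuous_const

theorem ofReal_fracHeatEvolution (s t : ℝ) (u₀ : EuclideanSpace ℝ (Fin n) → ℝ) :
    (fun x => (fracHeatEvolution s u₀ t x : ℂ))
      = convolution (fun y => (u₀ y : ℂ)) (fun y => (fracHeatKernel s t y : ℂ))
          (ContinuousLinearMap.mul ℂ ℂ) volume := by
  ext x
  rw [fracHeatEvolution, convolution_def, ← integral_complex_ofReal]
  refine integral_congr_ae (Eventually.of_forall fun y => ?_)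
  simp [mul_comm]

theorem integrable_fracHeatEvolution (hn : 1 ≤ n) (hs0 : 0 < s) (hs1 : s < 1) (ht : 0 < t)
    (hu : Integrable u₀) : Integrable (fracHeatEvolution s u₀ t) := by
  have h : Integrable fun x => (fracHeatEvolution s u₀ t x : ℂ) := by
    rw [ofReal_fracHeatEvolution]
    exact hu.ofReal.integrable_convolution _ (integrable_fracHeatKernel hn hs0 hs1 ht).ofReal
  simpa using h.re

theorem fourier_fracHeatEvolution (hn : 1 ≤ n) (hs0 : 0 < s) (hs1 : s < 1) (ht : 0 < t)
    (hu : Integrable u₀) (ξ : EuclideanSpace ℝ (Fin n)) :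
    𝓕 (fun x => (fracHeatEvolution s u₀ t x : ℂ)) ξ
      = 𝓕 (fun x => (u₀ x : ℂ)) ξ * fracHeatMultiplier s t ξ := by
  have h := Real.fourier_mul_convolution_eq (R := ℂ) hu.complex_ofReal
    (integrable_fracHeatKernel hn hs0 hs1 ht).complex_ofReal ξ
  rw [fourier_fracHeatKernel hn hs0 hs1 ht] at h
  rw [ofReal_fracHeatEvolution]
  exact h

theorem hasDerivAt_fracHeatMultiplier (s t : ℝ) (ξ : EuclideanSpace ℝ (Fin n)) :
    HasDerivAt (fun τ : ℝ => fracHeatMultiplier s τ ξ)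
      (-(fracLaplacianSymbol s ξ : ℂ) * fracHeatMultiplier s t ξ) t := by
  have h1 : HasDerivAt (fun τ : ℝ => Real.exp (-τ * fracLaplacianSymbol s ξ))
      (Real.exp (-t * fracLaplacianSymbol s ξ) * (-1 * fracLaplacianSymbol s ξ)) t :=
    (((hasDerivAt_id t).neg).mul_const _).exp
  convert! h1.ofReal_comp using 1
  simp only [fracHeatMultiplier]
  push_cast
  ring

theorem fracHeatKernel_smul (hn : 1 ≤ n) (hs0 : 0 < s) (hs1 : s < 1) (ht : 0 < t)
    (z : EuclideanSpace ℝ (Fin n)) :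
    t ^ ((n : ℝ) / (2 * s)) * fracHeatKernel s t (t ^ (1 / (2 * s)) • z) = fracHeatKernel s 1 z := by
  have h := pow_mul_fourierInv_mul_fracHeatMultiplier hs0 ht (fun _ => 1) z
  simp only [one_mul] at h
  rw [← ofReal_fracHeatKernel hn hs0 hs1 ht, ← ofReal_fracHeatKernel hn hs0 hs1 one_pos] at h
  exact_mod_cast h

/-- The kernel has integral 1, so `u₀ x` can be moved under the integral; Tonelli then separates the
variables. -/
theorem lintegral_enorm_fracHeatEvolution_sub_le (hn : 1 ≤ n) (hs0 : 0 < s) (hs1 : s < 1)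
    (ht : 0 < t) (hu : Integrable u₀) :
    ∫⁻ x, ‖fracHeatEvolution s u₀ t x - u₀ x‖ₑ
      ≤ ∫⁻ y, ‖fracHeatKernel s t y‖ₑ * ∫⁻ x, ‖u₀ (x - y) - u₀ x‖ₑ := by
  have hP := continuous_fracHeatKernel (n := n) hn hs0 ht
  have hPi := integrable_fracHeatKernel (n := n) hn hs0 hs1 ht
  have hpt : ∀ x, ‖fracHeatEvolution s u₀ t x - u₀ x‖ₑ
      ≤ ∫⁻ y, ‖fracHeatKernel s t y * (u₀ (x - y) - u₀ x)‖ₑ := by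
    intro x
    have h1 : fracHeatEvolution s u₀ t x = ∫ y, fracHeatKernel s t y * u₀ (x - y) := by
      rw [fracHeatEvolution,
        ← integral_sub_left_eq_self (fun y => fracHeatKernel s t y * u₀ (x - y)) volume x]
      simp
    have hi : Integrable fun y => fracHeatKernel s t y * u₀ (x - y) := by
      have := (integrable_fracHeatKernel_sub_mul hn hs0 ht hu x).comp_sub_left x
      simpa using this
    have h2 : u₀ x = ∫ y : EuclideanSpace ℝ (Fin n), fracHeatKernel s t y * u₀ x := by
      rw [integral_mul_const, integral_fracHeatKernel hn hs0 hs1 ht, one_mul]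
    have h3 : fracHeatEvolution s u₀ t x - u₀ x
        = ∫ y, fracHeatKernel s t y * (u₀ (x - y) - u₀ x) := by
      simp only [mul_sub]
      rw [integral_sub hi (hPi.mul_const _), ← h1, ← h2]
    rw [h3]
    exact enorm_integral_le_lintegral_enorm _
  have hmeas : AEStronglyMeasurable (fun q : EuclideanSpace ℝ (Fin n) × EuclideanSpace ℝ (Fin n) =>
      u₀ (q.1 - q.2)) (volume.prod volume) :=
    hu.aestronglyMeasurable.comp_quasiMeasurePreserving
      (quasiMeasurePreserving_sub_of_right_invariant volume volume)
  refine (lintegral_mono hpt).trans_eq ?_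
  rw [lintegral_lintegral_swap]
  · refine lintegral_congr fun y => ?_
    simp only [enorm_mul]
    rw [lintegral_const_mul' _ _ enorm_ne_top]
  · refine AEStronglyMeasurable.enorm ?_
    exact ((hP.comp continuous_snd).aestronglyMeasurable).mul
      (hmeas.sub hu.aestronglyMeasurable.comp_fst)

/-- The substitution `y = t^{1/2s} z` freezes the kernel at time 1 and leaves `ω(t^{1/2s} z)`, which
is bounded and tends to 0. -/
theorem tendsto_eLpNorm_fracHeatEvolution_sub (hn : 1 ≤ n) (hs0 : 0 < s) (hs1 : s < 1)
    (hu : Integrable u₀) :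
    Tendsto (fun t => eLpNorm (fun x => fracHeatEvolution s u₀ t x - u₀ x) 1 volume)
      (𝓝[>] 0) (𝓝 0) := by
  obtain ⟨ω, hωc, hω0, hωnn, ⟨B, hB⟩, hω⟩ := exists_L1_translation_modulus hu
  have hP1 := integrable_fracHeatKernel (n := n) hn hs0 hs1 one_pos
  have hle : ∀ t : ℝ, 0 < t → eLpNorm (fun x => fracHeatEvolution s u₀ t x - u₀ x) 1 volume
      ≤ ENNReal.ofReal (∫ z, ‖fracHeatKernel s 1 z‖ * ω (t ^ (1 / (2 * s)) • z)) := by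
    intro t ht
    have hPi := integrable_fracHeatKernel (n := n) hn hs0 hs1 ht
    set τ := t ^ (1 / (2 * s)) with hτ
    have hτ0 : 0 < τ := by positivity
    have hint : Integrable fun y => ‖fracHeatKernel s t y‖ * ω y :=
      hPi.norm.mul_bdd (c := B) hωc.aestronglyMeasurable
        (Eventually.of_forall fun y => by rw [Real.norm_of_nonneg (hωnn y)]; exact hB y)
    rw [eLpNorm_one_eq_lintegral_enorm]
    refine (lintegral_enorm_fracHeatEvolution_sub_le hn hs0 hs1 ht hu).trans_eq ?_
    have h1 : ∀ y, ‖fracHeatKernel s t y‖ₑ * ∫⁻ x, ‖u₀ (x - y) - u₀ x‖ₑ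
        = ENNReal.ofReal (‖fracHeatKernel s t y‖ * ω y) := fun y => by
      rw [hω, ← ofReal_norm, ENNReal.ofReal_mul (norm_nonneg _)]
    simp only [h1]
    rw [← ofReal_integral_eq_lintegral_ofReal hint
      (Eventually.of_forall fun y => mul_nonneg (norm_nonneg _) (hωnn y))]
    congr 1
    have h2 := Measure.integral_comp_smul (volume : Measure (EuclideanSpace ℝ (Fin n)))
      (fun y => ‖fracHeatKernel s t y‖ * ω y) τ
    rw [finrank_euclideanSpace_fin, abs_of_nonneg (by positivity), smul_eq_mul] at h2
    have h3 : ∀ z : EuclideanSpace ℝ (Fin n), ‖fracHeatKernel s 1 z‖ * ω (τ • z)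
        = τ ^ n * (‖fracHeatKernel s t (τ • z)‖ * ω (τ • z)) := fun z => by
      rw [← fracHeatKernel_smul hn hs0 hs1 ht z, ← hτ, rpow_natCast_div_eq ht.le, ← hτ, norm_mul,
        Real.norm_of_nonneg (by positivity : 0 ≤ τ ^ n), mul_assoc]
    simp only [h3]
    rw [integral_const_mul, h2, ← mul_assoc, mul_inv_cancel₀ (by positivity), one_mul]
  have hτlim : Tendsto (fun t : ℝ => t ^ (1 / (2 * s))) (𝓝[>] 0) (𝓝 0) := by
    have h := (Real.continuousAt_rpow_const 0 (1 / (2 * s)) (Or.inr (by positivity))).tendsto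
    rw [Real.zero_rpow (by positivity)] at h
    exact h.mono_left nhdsWithin_le_nhds
  have hlim : Tendsto (fun t : ℝ => ∫ z, ‖fracHeatKernel s 1 z‖ * ω (t ^ (1 / (2 * s)) • z))
      (𝓝[>] 0) (𝓝 (∫ _ : EuclideanSpace ℝ (Fin n), (0 : ℝ))) := by
    refine tendsto_integral_filter_of_dominated_convergence
      (fun z => ‖fracHeatKernel s 1 z‖ * B) (Eventually.of_forall fun t => ?_)
      (Eventually.of_forall fun t => Eventually.of_forall fun z => ?_) (hP1.norm.mul_const B)
      (Eventually.of_forall fun z => ?_)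
    · exact hP1.norm.aestronglyMeasurable.mul
        (hωc.comp (continuous_const_smul _)).aestronglyMeasurable
    · rw [Real.norm_of_nonneg (mul_nonneg (norm_nonneg _) (hωnn _))]
      exact mul_le_mul_of_nonneg_left (hB _) (norm_nonneg _)
    · have h1 : Tendsto (fun t : ℝ => ω (t ^ (1 / (2 * s)) • z)) (𝓝[>] 0) (𝓝 (ω ((0 : ℝ) • z))) :=
        (hωc.tendsto _).comp (hτlim.smul_const z)
      rw [zero_smul, hω0] at h1
      simpa using h1.const_mul ‖fracHeatKernel s 1 z‖
  rw [integral_zero] at hlim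
  have hlim' := ENNReal.tendsto_ofReal hlim
  rw [ENNReal.ofReal_zero] at hlim'
  refine tendsto_of_tendsto_of_tendsto_of_le_of_le' tendsto_const_nhds hlim'
    (Eventually.of_forall fun _ => zero_le) ?_
  filter_upwards [self_mem_nhdsWithin] with t ht
  exact hle t ht

theorem isFracHeatSolution_fracHeatEvolution (hn : 1 ≤ n) (hs0 : 0 < s) (hs1 : s < 1)
    (hu : Integrable u₀) : IsFracHeatSolution s u₀ (fracHeatEvolution s u₀) where
  integrable _ ht := integrable_fracHeatEvolution hn hs0 hs1 ht hu
  continuous _ ht := continuous_fracHeatEvolution hn hs0 ht hu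
  equation ξ t ht := by
    have h := (hasDerivAt_fracHeatMultiplier s t ξ).const_mul (𝓕 (fun x => (u₀ x : ℂ)) ξ)
    rw [fourier_fracHeatEvolution hn hs0 hs1 ht hu]
    refine (h.congr_deriv (by ring)).congr_of_eventuallyEq ?_
    filter_upwards [lt_mem_nhds ht] with τ hτ
    exact fourier_fracHeatEvolution hn hs0 hs1 hτ hu ξ
  initial := tendsto_eLpNorm_fracHeatEvolution_sub hn hs0 hs1 hu

/-! ### Uniqueness of solutions through the Fourier transform. -/

theorem norm_fourier_sub_le {f g : EuclideanSpace ℝ (Fin n) → ℝ} (hf : Integrable f)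
    (hg : Integrable g) (ξ : EuclideanSpace ℝ (Fin n)) :
    ‖𝓕 (fun x => (f x : ℂ)) ξ - 𝓕 (fun x => (g x : ℂ)) ξ‖
      ≤ (eLpNorm (fun x => f x - g x) 1 volume).toReal := by
  have h1 := (Real.fourierIntegral_convergent_iff ξ).2 hf.complex_ofReal
  have h2 := (Real.fourierIntegral_convergent_iff ξ).2 hg.complex_ofReal
  rw [Real.fourier_eq, Real.fourier_eq, ← integral_sub h1 h2, eLpNorm_one_eq_lintegral_enorm,
    ← integral_norm_eq_lintegral_enorm (f := fun x => f x - g x) (hf.sub hg).aestronglyMeasurable]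
  refine (norm_integral_le_integral_norm _).trans_eq ?_
  refine integral_congr_ae (Eventually.of_forall fun x => ?_)
  simp only
  rw [← smul_sub, Circle.norm_smul, ← Complex.ofReal_sub, Complex.norm_real]

theorem IsFracHeatSolution.fourier_eq {u : ℝ → EuclideanSpace ℝ (Fin n) → ℝ}
    (hsol : IsFracHeatSolution s u₀ u) (hu : Integrable u₀) (ht : 0 < t)
    (ξ : EuclideanSpace ℝ (Fin n)) :
    𝓕 (fun x => (u t x : ℂ)) ξ = 𝓕 (fun x => (u₀ x : ℂ)) ξ * fracHeatMultiplier s t ξ := by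
  set v : ℝ → ℂ := fun τ => 𝓕 (fun x => (u τ x : ℂ)) ξ with hv
  -- Integrating factor: the multiplier at time `-τ` is `exp(+τ|·|^{2s})`, so `w` is constant for `τ
  -- > 0`; the `L¹` initial condition identifies the constant.
  set w : ℝ → ℂ := fun τ => v τ * fracHeatMultiplier s (-τ) ξ with hw
  have hd : ∀ τ : ℝ, 0 < τ → HasDerivAt w 0 τ := by
    intro τ hτ
    have h1 := hsol.equation ξ τ hτ
    have h2 := (hasDerivAt_fracHeatMultiplier s (-τ) ξ).scomp τ (hasDerivAt_neg τ)
    refine (h1.mul h2).congr_deriv ?_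
    simp
    ring
  have hconst : ∀ τ : ℝ, 0 < τ → w τ = w t := by
    intro τ hτ
    refine (convex_Ioi (0 : ℝ)).is_const_of_fderivWithin_eq_zero (𝕜 := ℝ)
      (fun x hx => (hd x hx).differentiableAt.differentiableWithinAt) (fun x hx => ?_) hτ ht
    rw [fderivWithin_of_isOpen isOpen_Ioi hx]
    have := (hd x hx).hasFDerivAt.fderiv
    rw [this]
    ext
    simp
  have hlim : Tendsto v (𝓝[>] 0) (𝓝 (𝓕 (fun x => (u₀ x : ℂ)) ξ)) := by
    rw [tendsto_iff_norm_sub_tendsto_zero]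
    have h0 : Tendsto (fun t => (eLpNorm (fun x => u t x - u₀ x) 1 volume).toReal) (𝓝[>] 0)
        (𝓝 0) := by
      simpa [Function.comp_def] using (ENNReal.tendsto_toReal ENNReal.zero_ne_top).comp hsol.initial
    refine squeeze_zero' (Eventually.of_forall fun _ => norm_nonneg _) ?_ h0
    filter_upwards [self_mem_nhdsWithin] with τ hτ
    exact norm_fourier_sub_le (hsol.integrable τ hτ) hu ξ
  have hm0 : fracHeatMultiplier s 0 ξ = 1 := by simp [fracHeatMultiplier]
  have hmlim : Tendsto (fun τ : ℝ => fracHeatMultiplier s (-τ) ξ) (𝓝[>] 0) (𝓝 1) := by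
    have h1 := (hasDerivAt_fracHeatMultiplier s (-0) ξ).continuousAt.tendsto.comp
      (continuous_neg.tendsto (0 : ℝ))
    rw [neg_zero, hm0] at h1
    exact h1.mono_left nhdsWithin_le_nhds
  have hwlim := hlim.mul hmlim
  rw [mul_one] at hwlim
  have hwt : w t = 𝓕 (fun x => (u₀ x : ℂ)) ξ := by
    refine tendsto_nhds_unique (tendsto_const_nhds.congr' ?_) hwlim
    filter_upwards [self_mem_nhdsWithin] with τ hτ
    exact (hconst τ hτ).symm
  rw [← hwt]
  change v t = v t * fracHeatMultiplier s (-t) ξ * fracHeatMultiplier s t ξ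
  rw [mul_assoc]
  have : fracHeatMultiplier s (-t) ξ * fracHeatMultiplier s t ξ = 1 := by
    simp only [fracHeatMultiplier, ← Complex.ofReal_mul, ← Real.exp_add]
    simp
  rw [this, mul_one]

theorem norm_fourier_ofReal_le (u₀ : EuclideanSpace ℝ (Fin n) → ℝ) (ξ : EuclideanSpace ℝ (Fin n)) :
    ‖𝓕 (fun x => (u₀ x : ℂ)) ξ‖ ≤ ∫ x, ‖u₀ x‖ := by
  rw [Real.fourier_eq]
  refine (norm_integral_le_integral_norm _).trans_eq ?_
  simp only [Circle.norm_smul, Complex.norm_real]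

theorem integrable_fourier_mul_fracHeatMultiplier (hn : 1 ≤ n) (hs0 : 0 < s) (ht : 0 < t)
    (hu : Integrable u₀) :
    Integrable fun ξ => 𝓕 (fun x => (u₀ x : ℂ)) ξ * fracHeatMultiplier s t ξ :=
  (integrable_fracHeatMultiplier hn hs0 ht).bdd_mul (c := ∫ x, ‖u₀ x‖)
    (Real.continuous_fourier hu.ofReal).aestronglyMeasurable
    (Eventually.of_forall fun ξ => norm_fourier_ofReal_le u₀ ξ)

/-- Continuity of `u t` gives Fourier inversion at every point rather than almost everywhere. -/
theorem IsFracHeatSolution.ofReal_eq {u : ℝ → EuclideanSpace ℝ (Fin n) → ℝ}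
    (hsol : IsFracHeatSolution s u₀ u) (hn : 1 ≤ n) (hs0 : 0 < s) (hu : Integrable u₀) (ht : 0 < t)
    (x : EuclideanSpace ℝ (Fin n)) :
    (u t x : ℂ) = 𝓕⁻ (fun ξ => 𝓕 (fun x => (u₀ x : ℂ)) ξ * fracHeatMultiplier s t ξ) x := by
  have hF : 𝓕 (fun x => (u t x : ℂ))
      = fun ξ => 𝓕 (fun x => (u₀ x : ℂ)) ξ * fracHeatMultiplier s t ξ :=
    funext fun ξ => hsol.fourier_eq hu ht ξ
  have hc : Continuous fun x => (u t x : ℂ) := Complex.continuous_ofReal.comp (hsol.continuous t ht)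
  have h := hc.fourierInv_fourier_eq (hsol.integrable t ht).ofReal
    (by rw [hF]; exact integrable_fourier_mul_fracHeatMultiplier hn hs0 ht hu)
  rw [hF] at h
  exact (congrFun h x).symm

theorem IsFracHeatSolution.eq_fracHeatEvolution {u : ℝ → EuclideanSpace ℝ (Fin n) → ℝ}
    (hsol : IsFracHeatSolution s u₀ u) (hn : 1 ≤ n) (hs0 : 0 < s) (hs1 : s < 1)
    (hu : Integrable u₀) (ht : 0 < t) : u t = fracHeatEvolution s u₀ t := by
  ext x
  have h1 := hsol.ofReal_eq hn hs0 hu ht x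
  have h2 := (isFracHeatSolution_fracHeatEvolution hn hs0 hs1 hu).ofReal_eq hn hs0 hu ht x
  exact_mod_cast h1.trans h2.symm

end evolution

/-! ### Convergence to the kernel and optimality -/

section asymptotics

variable {n : ℕ} {s t : ℝ} {u₀ : EuclideanSpace ℝ (Fin n) → ℝ}

theorem fourierInv_sub {f g : EuclideanSpace ℝ (Fin n) → ℂ} (hf : Integrable f)
    (hg : Integrable g) (x : EuclideanSpace ℝ (Fin n)) :
    𝓕⁻ (fun ξ => f ξ - g ξ) x = 𝓕⁻ f x - 𝓕⁻ g x := by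
  have h1 := (Real.fourierIntegral_convergent_iff (-x)).2 hf
  have h2 := (Real.fourierIntegral_convergent_iff (-x)).2 hg
  simp only [Real.fourierInv_eq_fourier_neg]
  rw [Real.fourier_eq, Real.fourier_eq, Real.fourier_eq, ← integral_sub h1 h2]
  simp only [smul_sub]

theorem fourierInv_const_mul (c : ℂ) (f : EuclideanSpace ℝ (Fin n) → ℂ)
    (x : EuclideanSpace ℝ (Fin n)) : 𝓕⁻ (fun ξ => c * f ξ) x = c * 𝓕⁻ f x := by
  rw [Real.fourierInv_eq, Real.fourierInv_eq, ← integral_const_mul]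
  refine integral_congr_ae (Eventually.of_forall fun ξ => ?_)
  simp only [Circle.smul_def, smul_eq_mul]
  ring

theorem fourier_ofReal_sub_integral_eq (hu : Integrable u₀) (ξ : EuclideanSpace ℝ (Fin n)) :
    𝓕 (fun x => (u₀ x : ℂ)) ξ - ((∫ y, u₀ y : ℝ) : ℂ)
      = ∫ y, ((Real.fourierChar (-inner ℝ y ξ) : ℂ) - 1) * u₀ y := by
  have h1 := (Real.fourierIntegral_convergent_iff ξ).2 hu.complex_ofReal
  rw [Real.fourier_eq, ← integral_complex_ofReal, ← integral_sub h1 hu.complex_ofReal]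
  refine integral_congr_ae (Eventually.of_forall fun y => ?_)
  simp only [Circle.smul_def, smul_eq_mul]
  ring

theorem norm_fourierChar_neg_inner_sub_one_mul_le (y ξ : EuclideanSpace ℝ (Fin n)) (a : ℝ) :
    ‖((Real.fourierChar (-inner ℝ y ξ) : ℂ) - 1) * a‖ ≤ 2 * Real.pi * ‖ξ‖ * (‖y‖ * |a|) := by
  rw [norm_mul, Complex.norm_real, Real.norm_eq_abs]
  have h1 := norm_fourierChar_sub_one_le (-inner ℝ y ξ)
  rw [abs_neg] at h1
  have h2 : |inner ℝ y ξ| ≤ ‖y‖ * ‖ξ‖ := abs_real_inner_le_norm y ξ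
  calc _ ≤ (2 * Real.pi * (‖y‖ * ‖ξ‖)) * |a| := by
        refine mul_le_mul_of_nonneg_right (h1.trans ?_) (abs_nonneg _)
        exact mul_le_mul_of_nonneg_left h2 Real.two_pi_pos.le
    _ = _ := by ring

theorem norm_fourier_ofReal_sub_integral_le (hu : HasFiniteFirstMoment u₀)
    (ξ : EuclideanSpace ℝ (Fin n)) :
    ‖𝓕 (fun x => (u₀ x : ℂ)) ξ - ((∫ y, u₀ y : ℝ) : ℂ)‖
      ≤ 2 * Real.pi * firstAbsMoment u₀ * ‖ξ‖ := by
  rw [fourier_ofReal_sub_integral_eq hu.1]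
  refine (norm_integral_le_of_norm_le (hu.2.const_mul (2 * Real.pi * ‖ξ‖))
    (Eventually.of_forall fun y => norm_fourierChar_neg_inner_sub_one_mul_le y ξ _)).trans_eq ?_
  rw [integral_const_mul, firstAbsMoment]
  ring

theorem HasFiniteFirstMoment.integrable_smul (hu : HasFiniteFirstMoment u₀) :
    Integrable fun y => u₀ y • y := by
  refine hu.2.mono' (hu.1.aestronglyMeasurable.smul aestronglyMeasurable_id)
    (Eventually.of_forall fun y => ?_)
  rw [norm_smul, Real.norm_eq_abs, mul_comm]

/-- First-order expansion of `û₀` at the origin, by dominated convergence; it makes `b = -∫ u₀(y) y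
dy`. -/
theorem tendsto_mul_fourier_ofReal_sub_integral (hu : HasFiniteFirstMoment u₀)
    (ξ : EuclideanSpace ℝ (Fin n)) :
    Tendsto (fun τ : ℝ => (τ : ℂ) *
        (𝓕 (fun x => (u₀ x : ℂ)) (τ⁻¹ • ξ) - ((∫ y, u₀ y : ℝ) : ℂ))) atTop
      (𝓝 (2 * Real.pi * Complex.I * (inner ℝ (-∫ y, u₀ y • y) ξ : ℝ))) := by
  have hv := hu.integrable_smul
  have hval : (2 * Real.pi * Complex.I * (inner ℝ (-∫ y, u₀ y • y) ξ : ℝ) : ℂ)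
      = ∫ y, 2 * Real.pi * Complex.I * ((-inner ℝ y ξ : ℝ) : ℂ) * u₀ y := by
    have h1 : inner ℝ (-∫ y, u₀ y • y) ξ = ∫ y, -inner ℝ y ξ * u₀ y := by
      rw [inner_neg_left, real_inner_comm, ← integral_inner hv, ← integral_neg]
      refine integral_congr_ae (Eventually.of_forall fun y => ?_)
      simp only [inner_smul_right, real_inner_comm ξ]
      ring
    rw [h1, ← integral_complex_ofReal, ← integral_const_mul]
    refine integral_congr_ae (Eventually.of_forall fun y => ?_)
    simp only [Complex.ofReal_mul]
    ring
  rw [hval]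
  simp only [fourier_ofReal_sub_integral_eq hu.1, ← integral_const_mul]
  refine tendsto_integral_filter_of_dominated_convergence
    (fun y => 2 * Real.pi * ‖ξ‖ * (‖y‖ * |u₀ y|)) (Eventually.of_forall fun τ => ?_) ?_
    (hu.2.const_mul _) (Eventually.of_forall fun y => ?_)
  · refine AEStronglyMeasurable.const_mul (AEStronglyMeasurable.mul ?_
      hu.1.complex_ofReal.aestronglyMeasurable) _
    exact ((continuous_subtype_val.comp (Real.continuous_fourierChar.comp
      (by fun_prop : Continuous fun y => -inner ℝ y (τ⁻¹ • ξ)))).sub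
        continuous_const).aestronglyMeasurable
  · filter_upwards [eventually_gt_atTop 0] with τ hτ
    refine Eventually.of_forall fun y => ?_
    rw [norm_mul, Complex.norm_real, Real.norm_of_nonneg hτ.le]
    refine (mul_le_mul_of_nonneg_left
      (norm_fourierChar_neg_inner_sub_one_mul_le y (τ⁻¹ • ξ) (u₀ y)) hτ.le).trans_eq ?_
    rw [norm_smul, norm_inv, Real.norm_of_nonneg hτ.le]
    field_simp
  · refine ((tendsto_mul_fourierChar_sub_one (-inner ℝ y ξ)).mul_const (u₀ y : ℂ)).congr fun τ => ?_
    rw [inner_smul_right, mul_neg, mul_assoc]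

theorem IsFracHeatSolution.ofReal_sub_eq {u : ℝ → EuclideanSpace ℝ (Fin n) → ℝ}
    (hsol : IsFracHeatSolution s u₀ u) (hn : 1 ≤ n) (hs0 : 0 < s) (hs1 : s < 1)
    (hu : Integrable u₀) (ht : 0 < t) (x : EuclideanSpace ℝ (Fin n)) :
    ((u t x - (∫ y, u₀ y) * fracHeatKernel s t x : ℝ) : ℂ)
      = 𝓕⁻ (fun ξ => (𝓕 (fun x => (u₀ x : ℂ)) ξ - ((∫ y, u₀ y : ℝ) : ℂ))
          * fracHeatMultiplier s t ξ) x := by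
  simp only [sub_mul]
  rw [fourierInv_sub (integrable_fourier_mul_fracHeatMultiplier hn hs0 ht hu)
    ((integrable_fracHeatMultiplier hn hs0 ht).const_mul _), ← hsol.ofReal_eq hn hs0 hu ht,
    fourierInv_const_mul, ← ofReal_fracHeatKernel hn hs0 hs1 ht]
  push_cast
  rfl

theorem fracHeatEvolution_sub_eq (hn : 1 ≤ n) (hs0 : 0 < s) (ht : 0 < t) (hu : Integrable u₀)
    (x : EuclideanSpace ℝ (Fin n)) :
    fracHeatEvolution s u₀ t x - (∫ y, u₀ y) * fracHeatKernel s t x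
      = ∫ y, (fracHeatKernel s t (x - y) - fracHeatKernel s t x) * u₀ y := by
  simp only [sub_mul]
  rw [integral_sub (integrable_fracHeatKernel_sub_mul hn hs0 ht hu x) (hu.const_mul _),
    integral_const_mul, fracHeatEvolution, mul_comm (fracHeatKernel s t x)]

/-- Translating the kernel by `-y` costs `D‖y‖` in `L¹`; integrating against `|u₀ y|` produces the
first moment. -/
theorem eLpNorm_fracHeatEvolution_sub_le (hn : 1 ≤ n) (hs0 : 0 < s) (ht : 0 < t)
    (hu : HasFiniteFirstMoment u₀) {D : ℝ} (hD : 0 ≤ D)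
    (hP : ∀ h : EuclideanSpace ℝ (Fin n),
      ∫⁻ x, ‖fracHeatKernel s t (x + h) - fracHeatKernel s t x‖ₑ ≤ ENNReal.ofReal (D * ‖h‖)) :
    eLpNorm (fun x => fracHeatEvolution s u₀ t x - (∫ y, u₀ y) * fracHeatKernel s t x) 1 volume
      ≤ ENNReal.ofReal (D * firstAbsMoment u₀) := by
  have hPc := continuous_fracHeatKernel (n := n) hn hs0 ht
  rw [eLpNorm_one_eq_lintegral_enorm]
  calc ∫⁻ x, ‖fracHeatEvolution s u₀ t x - (∫ y, u₀ y) * fracHeatKernel s t x‖ₑ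
      ≤ ∫⁻ x, ∫⁻ y, ‖(fracHeatKernel s t (x - y) - fracHeatKernel s t x) * u₀ y‖ₑ := by
        refine lintegral_mono fun x => ?_
        rw [fracHeatEvolution_sub_eq hn hs0 ht hu.1]
        exact enorm_integral_le_lintegral_enorm _
    _ = ∫⁻ y, ∫⁻ x, ‖(fracHeatKernel s t (x - y) - fracHeatKernel s t x) * u₀ y‖ₑ := by
        refine lintegral_lintegral_swap (AEStronglyMeasurable.enorm ?_)
        refine AEStronglyMeasurable.mul (Continuous.aestronglyMeasurable ?_)
          hu.1.aestronglyMeasurable.comp_snd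
        exact (hPc.comp (continuous_fst.sub continuous_snd)).sub (hPc.comp continuous_fst)
    _ ≤ ∫⁻ y, ENNReal.ofReal (D * (‖y‖ * |u₀ y|)) := by
        refine lintegral_mono fun y => ?_
        simp only [enorm_mul]
        rw [lintegral_mul_const' _ _ enorm_ne_top]
        have h := hP (-y)
        simp only [← sub_eq_add_neg, norm_neg] at h
        refine (mul_le_mul_left h _).trans_eq ?_
        rw [← ofReal_norm, ← ENNReal.ofReal_mul (by positivity), Real.norm_eq_abs, mul_assoc]
    _ = ENNReal.ofReal (D * firstAbsMoment u₀) := by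
        rw [← ofReal_integral_eq_lintegral_ofReal (hu.2.const_mul D)
          (Eventually.of_forall fun y => by positivity), integral_const_mul, firstAbsMoment]

theorem ofReal_fracHeatKernel_comp_add_sub (hn : 1 ≤ n) (hs0 : 0 < s) (hs1 : s < 1) (ht : 0 < t)
    (h x : EuclideanSpace ℝ (Fin n)) :
    ((fracHeatKernel s t (x + h) - fracHeatKernel s t x : ℝ) : ℂ)
      = 𝓕⁻ (fun ξ => ((Real.fourierChar (inner ℝ h ξ) : ℂ) - 1) * fracHeatMultiplier s t ξ) x := by
  have hi := integrable_fracHeatMultiplier (n := n) hn hs0 ht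
  have hi' : Integrable fun ξ : EuclideanSpace ℝ (Fin n) =>
      (Real.fourierChar (inner ℝ h ξ) : ℂ) * fracHeatMultiplier s t ξ := by
    refine hi.bdd_mul (c := 1) ?_ (Eventually.of_forall fun ξ => (Circle.norm_coe _).le)
    exact (continuous_subtype_val.comp (Real.continuous_fourierChar.comp
      (by fun_prop : Continuous fun ξ => inner ℝ h ξ))).aestronglyMeasurable
  simp only [sub_mul, one_mul]
  rw [fourierInv_sub hi' hi, ← ofReal_fracHeatKernel hn hs0 hs1 ht, Complex.ofReal_sub,
    ofReal_fracHeatKernel hn hs0 hs1 ht (x + h), Real.fourierInv_eq, Real.fourierInv_eq]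
  congr 1
  refine integral_congr_ae (Eventually.of_forall fun ξ => ?_)
  simp only [Circle.smul_def, smul_eq_mul]
  rw [inner_add_right, AddChar.map_add_eq_mul, Circle.coe_mul, real_inner_comm h ξ, mul_assoc]

theorem exists_unit_mass_first_moment_ne_zero (hn : 1 ≤ n) :
    ∃ u₀ : EuclideanSpace ℝ (Fin n) → ℝ, HasFiniteFirstMoment u₀ ∧ (∫ y, u₀ y) = 1 ∧
      (∫ y, u₀ y • y) ≠ 0 := by
  -- The datum is the uniform density on the ball of radius `1/2` about a unit vector `e`. There
  -- `⟨e, y⟩ ≥ 1/2`, so the first moment has component at least `1/2` along `e`.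
  set e : EuclideanSpace ℝ (Fin n) := EuclideanSpace.single ⟨0, hn⟩ 1 with he
  have he1 : ‖e‖ = 1 := by simp [he]
  set B := Metric.ball e (1 / 2) with hB
  set V := (volume B).toReal with hV
  have hBfin : volume B ≠ ⊤ := measure_ball_lt_top.ne
  have hV0 : 0 < V := ENNReal.toReal_pos (Metric.measure_ball_pos volume e (by norm_num)).ne' hBfin
  set f : EuclideanSpace ℝ (Fin n) → ℝ := B.indicator fun _ => V⁻¹ with hf
  have hfi : Integrable f :=
    (integrable_indicator_iff Metric.isOpen_ball.measurableSet).2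
      (integrableOn_const hBfin)
  have hmass : ∫ y, f y = 1 := by
    rw [hf, integral_indicator Metric.isOpen_ball.measurableSet, setIntegral_const, smul_eq_mul]
    exact mul_inv_cancel₀ hV0.ne'
  have hfnn : ∀ y, 0 ≤ f y := fun y => Set.indicator_nonneg (fun _ _ => by positivity) y
  have hin : ∀ y ∈ B, ‖y‖ ≤ 3 / 2 ∧ 1 / 2 ≤ inner ℝ e y := by
    intro y hy
    rw [hB, Metric.mem_ball, dist_eq_norm] at hy
    constructor
    · have := norm_add_le (y - e) e
      rw [sub_add_cancel, he1] at this
      linarith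
    · have h1 : inner ℝ e y = 1 + inner ℝ e (y - e) := by
        rw [inner_sub_right, real_inner_self_eq_norm_sq, he1]
        ring
      have h2 := (abs_le.1 (abs_real_inner_le_norm e (y - e))).1
      rw [he1, one_mul] at h2
      linarith
  have hle : ∀ y, ‖y‖ * |f y| ≤ 3 / 2 * f y := by
    intro y
    rw [abs_of_nonneg (hfnn y)]
    by_cases hy : y ∈ B
    · exact mul_le_mul_of_nonneg_right (hin y hy).1 (hfnn y)
    · simp [hf, hy]
  have hmom : HasFiniteFirstMoment f := by
    refine ⟨hfi, (hfi.const_mul (3 / 2)).mono'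
      (continuous_norm.aestronglyMeasurable.mul hfi.aestronglyMeasurable.norm)
      (Eventually.of_forall fun y => ?_)⟩
    rw [Real.norm_of_nonneg (by positivity)]
    exact hle y
  refine ⟨f, hmom, hmass, fun h0 => ?_⟩
  have hv := hmom.integrable_smul
  have h1 : ∫ y, inner ℝ e (f y • y) = 0 := by rw [integral_inner hv, h0, inner_zero_right]
  have h2 : ∫ y, (1 / 2) * f y ≤ ∫ y, inner ℝ e (f y • y) := by
    refine integral_mono (hfi.const_mul _) (hv.const_inner e) fun y => ?_
    simp only [inner_smul_right]
    by_cases hy : y ∈ B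
    · rw [mul_comm]
      exact mul_le_mul_of_nonneg_left (hin y hy).2 (hfnn y)
    · simp [hf, hy]
  rw [h1, integral_const_mul, hmass] at h2
  norm_num at h2

end asymptotics

/-! ### Assembly of the estimates and of their optimality. -/

theorem theorem2 (n : ℕ) (hn : 1 ≤ n) (s : ℝ) (hs0 : 0 < s) (hs1 : s < 1) :
    -- the representation formula gives a solution for every integrable datum
    (∀ u₀ : EuclideanSpace ℝ (Fin n) → ℝ, Integrable u₀ →
      IsFracHeatSolution s u₀ (fracHeatEvolution s u₀)) ∧
    -- the two convergence estimates, with constants depending only on `n` and `s`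
    (∃ C₁ > (0 : ℝ), ∃ C₂ > (0 : ℝ),
      ∀ u₀ : EuclideanSpace ℝ (Fin n) → ℝ, HasFiniteFirstMoment u₀ →
      ∀ u : ℝ → EuclideanSpace ℝ (Fin n) → ℝ, IsFracHeatSolution s u₀ u →
      ∀ t : ℝ, 0 < t →
        (∀ x, t ^ ((n : ℝ) / (2 * s)) * |u t x - (∫ y, u₀ y) * fracHeatKernel s t x|
            ≤ C₁ * firstAbsMoment u₀ * t ^ (-(1 / (2 * s)))) ∧
        eLpNorm (fun x => u t x - (∫ y, u₀ y) * fracHeatKernel s t x) 1 volume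
            ≤ ENNReal.ofReal (C₂ * firstAbsMoment u₀ * t ^ (-(1 / (2 * s))))) ∧
    -- optimality: every nontrivial translate of the fundamental solution attains the rate exactly
    (∀ h : EuclideanSpace ℝ (Fin n), h ≠ 0 →
      ∃ c > (0 : ℝ), ∃ C > (0 : ℝ), ∃ T > (0 : ℝ), ∀ t : ℝ, T ≤ t →
        (∃ x, c * t ^ (-(1 / (2 * s))) ≤
          t ^ ((n : ℝ) / (2 * s)) * |fracHeatKernel s t (x + h) - fracHeatKernel s t x|) ∧
        (∀ x, t ^ ((n : ℝ) / (2 * s)) * |fracHeatKernel s t (x + h) - fracHeatKernel s t x|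
          ≤ C * t ^ (-(1 / (2 * s)))) ∧
        ENNReal.ofReal (c * t ^ (-(1 / (2 * s)))) ≤
          eLpNorm (fun x => fracHeatKernel s t (x + h) - fracHeatKernel s t x) 1 volume ∧
        eLpNorm (fun x => fracHeatKernel s t (x + h) - fracHeatKernel s t x) 1 volume
          ≤ ENNReal.ofReal (C * t ^ (-(1 / (2 * s))))) ∧
    -- optimality within the class of data of the estimates
    (∃ (u₀ : EuclideanSpace ℝ (Fin n) → ℝ) (u : ℝ → EuclideanSpace ℝ (Fin n) → ℝ),
      HasFiniteFirstMoment u₀ ∧ (∫ y, u₀ y) = 1 ∧ IsFracHeatSolution s u₀ u ∧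
      ∃ c > (0 : ℝ), ∃ T > (0 : ℝ), ∀ t : ℝ, T ≤ t →
        (∃ x, c * t ^ (-(1 / (2 * s))) ≤
          t ^ ((n : ℝ) / (2 * s)) * |u t x - (∫ y, u₀ y) * fracHeatKernel s t x|) ∧
        ENNReal.ofReal (c * t ^ (-(1 / (2 * s)))) ≤
          eLpNorm (fun x => u t x - (∫ y, u₀ y) * fracHeatKernel s t x) 1 volume) := by
  obtain ⟨D, hD0, hD⟩ := exists_lintegral_enorm_fracHeatKernel_comp_add_sub_le (n := n) hn hs0 hs1
  obtain ⟨I, hI⟩ : ∃ I, I = ∫ ξ : EuclideanSpace ℝ (Fin n), ‖ξ‖ * ‖fracHeatMultiplier s 1 ξ‖ :=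
    ⟨_, rfl⟩
  have hI0 : 0 ≤ I := by
    rw [hI]
    exact integral_nonneg fun ξ => by positivity
  refine ⟨fun u₀ hu => isFracHeatSolution_fracHeatEvolution hn hs0 hs1 hu, ?_, ?_, ?_⟩
  -- The summand 1 secures strict positivity, `I` being known only to be nonnegative.
  · refine ⟨2 * Real.pi * I + 1, by positivity, D, hD0, fun u₀ hu u hsol t ht => ⟨fun x => ?_, ?_⟩⟩
    · have hN : 0 ≤ firstAbsMoment u₀ := integral_nonneg fun y => by positivity
      have h := pow_mul_norm_fourierInv_mul_fracHeatMultiplier_le hn hs0 ht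
        (norm_fourier_ofReal_sub_integral_le hu) x
      rw [← hsol.ofReal_sub_eq hn hs0 hs1 hu.1 ht, Complex.norm_real, Real.norm_eq_abs, ← hI] at h
      refine h.trans (mul_le_mul_of_nonneg_right ?_ (by positivity))
      linarith
    · rw [hsol.eq_fracHeatEvolution hn hs0 hs1 hu.1 ht]
      refine (eLpNorm_fracHeatEvolution_sub_le hn hs0 ht hu (D := D * t ^ (-(1 / (2 * s))))
        (by positivity) fun h => (hD t ht h).trans_eq ?_).trans_eq ?_ <;>
      · congr 1
        ring
  · intro h hh
    have hA : Continuous fun ξ : EuclideanSpace ℝ (Fin n) =>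
        (Real.fourierChar (inner ℝ h ξ) : ℂ) - 1 :=
      (continuous_subtype_val.comp (Real.continuous_fourierChar.comp
        (by fun_prop : Continuous fun ξ => inner ℝ h ξ))).sub continuous_const
    have hK : ∀ ξ : EuclideanSpace ℝ (Fin n),
        ‖(Real.fourierChar (inner ℝ h ξ) : ℂ) - 1‖ ≤ 2 * Real.pi * ‖h‖ * ‖ξ‖ := fun ξ => by
      refine (norm_fourierChar_sub_one_le _).trans ?_
      rw [mul_assoc _ ‖h‖]
      exact mul_le_mul_of_nonneg_left (abs_real_inner_le_norm h ξ) Real.two_pi_pos.le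
    obtain ⟨c, hc0, T, hT0, hT⟩ := exists_lower_bound_of_multiplier hn hs0 hA hK hh fun ξ => by
      simp only [inner_smul_right]
      exact tendsto_mul_fourierChar_sub_one _
    have hh0 : 0 < ‖h‖ := norm_pos_iff.2 hh
    have hC : 0 < 2 * Real.pi * ‖h‖ * I + D * ‖h‖ :=
      add_pos_of_nonneg_of_pos (by positivity) (mul_pos hD0 hh0)
    -- The sum of the sup-norm and `L¹` constants serves both upper bounds.
    refine ⟨c, hc0, 2 * Real.pi * ‖h‖ * I + D * ‖h‖, hC, T, hT0, fun t htT => ?_⟩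
    have ht : 0 < t := hT0.trans_le htT
    have hi := integrable_fracHeatKernel (n := n) hn hs0 hs1 ht
    obtain ⟨h1, h2⟩ := hT t htT (fun x => fracHeatKernel s t (x + h) - fracHeatKernel s t x)
      (ofReal_fracHeatKernel_comp_add_sub hn hs0 hs1 ht h) ((hi.comp_add_right h).sub hi)
    refine ⟨h1, fun x => ?_, h2, ?_⟩
    · have h3 := pow_mul_norm_fourierInv_mul_fracHeatMultiplier_le hn hs0 ht hK x
      rw [← ofReal_fracHeatKernel_comp_add_sub hn hs0 hs1 ht, Complex.norm_real,
        Real.norm_eq_abs, ← hI] at h3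
      refine h3.trans (mul_le_mul_of_nonneg_right ?_ (by positivity))
      exact le_add_of_nonneg_right (by positivity)
    · rw [eLpNorm_one_eq_lintegral_enorm]
      refine (hD t ht h).trans (ENNReal.ofReal_le_ofReal (mul_le_mul_of_nonneg_right ?_ (by positivity)))
      exact le_add_of_nonneg_left (by positivity)
  · obtain ⟨u₀, hu, hmass, hb⟩ := exists_unit_mass_first_moment_ne_zero (n := n) hn
    have hsol := isFracHeatSolution_fracHeatEvolution hn hs0 hs1 hu.1
    refine ⟨u₀, fracHeatEvolution s u₀, hu, hmass, hsol, ?_⟩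
    have hA : Continuous fun ξ : EuclideanSpace ℝ (Fin n) =>
        𝓕 (fun x => (u₀ x : ℂ)) ξ - ((∫ y, u₀ y : ℝ) : ℂ) :=
      (Real.continuous_fourier hu.1.complex_ofReal).sub continuous_const
    obtain ⟨c, hc0, T, hT0, hT⟩ := exists_lower_bound_of_multiplier hn hs0 hA
      (norm_fourier_ofReal_sub_integral_le hu) (neg_ne_zero.2 hb)
      (tendsto_mul_fourier_ofReal_sub_integral hu)
    refine ⟨c, hc0, T, hT0, fun t htT => ?_⟩
    have ht : 0 < t := hT0.trans_le htT
    have hi : Integrable fun x =>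
        fracHeatEvolution s u₀ t x - (∫ y, u₀ y) * fracHeatKernel s t x :=
      (hsol.integrable t ht).sub ((integrable_fracHeatKernel hn hs0 hs1 ht).const_mul _)
    exact hT t htT (fun x => fracHeatEvolution s u₀ t x - (∫ y, u₀ y) * fracHeatKernel s t x)
      (fun x => hsol.ofReal_sub_eq hn hs0 hs1 hu.1 ht x) hi
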